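/- All functions are real valued unless their Fourier transforms are concerned. For $\sigma>0$ put $$\boldsymbol D^{-\sigma}w(x)=\frac1{\Gamma(\sigma)}\int_{-\infty}^x (x-t)^{\sigma-1}w(t)\,dt,\qquad \boldsymbol D^{-\sigma*}w(x)=\frac1{\Gamma(\sigma)}\int_x^{\infty}(t-x)^{\sigma-1}w(t)\,dt,$$ and for $s>0$, with $n$ the integer such that $n-1\le s<n$, put $\boldsymbol D^{s}w=\frac{d^n}{dx^n}\boldsymbol D^{-(n-s)}w$ and $\boldsymbol D^{s*}w=(-1)^n\frac{d^n}{dx^n}\boldsymbol D^{-(n-s)*}w$ (left and right Riemann–Liouville derivatives). For $v,w\in L^1_{loc}(\mathbb R)$, $w$ is the weak derivative $\boldsymbol D^{s}v$ if $\int v\,\boldsymbol D^{s*}\psi\,dx=\int w\,\psi\,dx$ for all $\psi\in C_0^\infty(\mathbb R)$, the left-hand integrals being absolutely convergent; it is the weak derivative $\boldsymbol D^{s*}v$ if the same holds with $\boldsymbol D^{s}\psi$ in place of $\boldsymbol D^{s*}\psi$. $Dv$ is the usual weak first derivative. With $\widehat w$ the Plancherel transform (kernel $e^{-2\pi i x\xi}$),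 let $$\widehat H^s(\mathbb R)=\Big\{w\in L^2(\mathbb R):\int_{\mathbb R}(1+|2\pi\xi|^{2s})|\widehat w(\xi)|^2\,d\xi<\infty\Big\},\qquad \|w\|_{\widehat H^s}^2=\|w\|_{L^2}^2+\int_{\mathbb R}|2\pi\xi|^{2s}|\widehat w(\xi)|^2\,d\xi .$$ Let $p,q,a,b,\mu\in\mathbb R$ with $0<\mu<1$, $b\ne0$, $p^2+q^2\neq0$, and let $Lu=p\boldsymbol D^{2-\mu}u+q\boldsymbol D^{(2-\mu)*}u+aDu+bu$, all derivatives being weak. Put $$\sigma_1=2-\mu,\quad \sigma_2=\tfrac{3-\mu}2,\quad \sigma_3=1,\quad \sigma_4=\tfrac{2-\mu}2,\quad \sigma_5=0,$$ $$C_1=p^2+q^2+2pq\cos(\sigma_1\pi),\quad C_2=2a(q-p)\cos(\sigma_2\pi),\quad C_3=a^2,\quad C_4=2b(p+q)\cos(\sigma_4\pi),\quad C_5=b^2 .$$ **Theorem.** Assume that one of the following holds: (i) $C_2\ge0$ and $C_4\ge0$; (ii) $C_2\ge0$, $C_4<0$, and there is $\alpha>0$ with $b^2>-C_4\,\alpha^{2(\sigma_5-\sigma_4)}$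 and $\sum_{j=1}^4 C_j\,\alpha^{-(2\sigma_j-1)}>0$; (iii) $C_2<0$, $C_4\ge0$, and there is $\alpha>0$ with $b^2>-\sum_{j=2}^4 C_j\,\alpha^{2(\sigma_5-\sigma_j)}$ and $\sum_{j=1}^2 C_j\,\alpha^{-(2\sigma_j-1)}>0$; (iv) $C_2<0$, $C_4<0$, and there is $\alpha>0$ with $b^2>-\sum_{j=2,4} C_j\,\alpha^{2(\sigma_5-\sigma_j)}$ and $\sum_{j=1,2,4} C_j\,\alpha^{-(2\sigma_j-1)}>0$. Then there is a constant $C>0$, depending only on $L$ (that is, on $p,q,a,b,\mu$), such that for every $f\in L^2(\mathbb R)$ there is a unique $u\in\widehat H^{2-\mu}(\mathbb R)$ (unique as an element of $L^2(\mathbb R)$) whose weak derivatives $\boldsymbol D^{2-\mu}u$, $\boldsymbol D^{(2-\mu)*}u$, $Du$ exist and which satisfies $Lu=f$ almost everywhere on $\mathbb R$; moreover this $u$ satisfies $\|u\|_{\widehat H^{2-\mu}(\mathbb R)}\le C\|f\|_{L^2(\mathbb R)}$. -/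

import Mathlib

open MeasureTheory
open scoped FourierTransform

noncomputable section

namespace FracODE

/-- Real-valued `L²(ℝ)`, as a space of almost-everywhere classes. -/
abbrev L2R : Type := Lp ℝ 2 (volume : Measure ℝ)

/-- The left Riemann-Liouville integral of order `σ > 0` based at `-∞`. -/
def leftIntegral (σ : ℝ) (w : ℝ → ℝ) (x : ℝ) : ℝ :=
  1 / Real.Gamma σ * ∫ t in Set.Iio x, (x - t) ^ (σ - 1) * w t

/-- The right Riemann-Liouville integral of order `σ > 0` based at `+∞`. -/
def rightIntegral (σ : ℝ) (w : ℝ → ℝ) (x : ℝ) : ℝ :=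
  1 / Real.Gamma σ * ∫ t in Set.Ioi x, (t - x) ^ (σ - 1) * w t

/-- The smallest integer `n` with `s < n` (for `s ≥ 0`), i.e. `n - 1 ≤ s < n`. -/
def rlOrder (s : ℝ) : ℕ := ⌊s⌋₊ + 1

/-- The left Riemann-Liouville derivative `D^s w = dⁿ/dxⁿ (D^{-(n-s)} w)`, `n - 1 ≤ s < n`. -/
def leftDeriv (s : ℝ) (w : ℝ → ℝ) : ℝ → ℝ :=
  iteratedDeriv (rlOrder s) (leftIntegral (rlOrder s - s) w)

/-- The right Riemann-Liouville derivative `D^{s*} w = (-1)ⁿ dⁿ/dxⁿ (D^{-(n-s)*} w)`. -/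
def rightDeriv (s : ℝ) (w : ℝ → ℝ) (x : ℝ) : ℝ :=
  (-1) ^ rlOrder s * iteratedDeriv (rlOrder s) (rightIntegral (rlOrder s - s) w) x

/-- Test functions: `ψ ∈ C₀^∞(ℝ)`. -/
def IsTest (ψ : ℝ → ℝ) : Prop :=
  ContDiff ℝ (⊤ : ℕ∞) ψ ∧ HasCompactSupport ψ

/-- `w` is the weak left derivative of order `s` of `v`: `(v, D^{s*} ψ) = (w, ψ)` for all test
functions `ψ`. The derivative of a test function need not have compact support, so that the
left-hand pairing is required to be an absolutely convergent integral. -/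
def IsWeakLeftDeriv (s : ℝ) (v w : ℝ → ℝ) : Prop :=
  LocallyIntegrable v ∧ LocallyIntegrable w ∧
    ∀ ψ : ℝ → ℝ, IsTest ψ →
      Integrable (fun x => v x * rightDeriv s ψ x) ∧
        ∫ x, v x * rightDeriv s ψ x = ∫ x, w x * ψ x

/-- `w` is the weak right derivative of order `s` of `v`: `(v, D^s ψ) = (w, ψ)` for all test
functions `ψ`. -/
def IsWeakRightDeriv (s : ℝ) (v w : ℝ → ℝ) : Prop :=
  LocallyIntegrable v ∧ LocallyIntegrable w ∧
    ∀ ψ : ℝ → ℝ, IsTest ψ →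
      Integrable (fun x => v x * leftDeriv s ψ x) ∧
        ∫ x, v x * leftDeriv s ψ x = ∫ x, w x * ψ x

/-- `w` is the usual weak first derivative of `v`. -/
def IsWeakDeriv (v w : ℝ → ℝ) : Prop :=
  LocallyIntegrable v ∧ LocallyIntegrable w ∧
    ∀ ψ : ℝ → ℝ, IsTest ψ → ∫ x, v x * deriv ψ x = - ∫ x, w x * ψ x

/-- The Plancherel transform of a real-valued `L²` function, with kernel `e^{-2πixξ}`. -/
def plancherel (u : L2R) : Lp ℂ 2 (volume : Measure ℝ) :=
  𝓕 (Complex.ofRealCLM.compLp u)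

/-- The Sobolev space `Ĥ^s(ℝ)`, `s ≥ 0`. -/
def HHat (s : ℝ) : Set L2R :=
  {u | Integrable (fun ξ : ℝ =>
    (1 + |2 * Real.pi * ξ| ^ (2 * s)) * ‖plancherel u ξ‖ ^ 2)}

/-- The norm of `Ĥ^s(ℝ)`, meaningful on members of `HHat s`. -/
def hhatNorm (s : ℝ) (u : L2R) : ℝ :=
  Real.sqrt (‖u‖ ^ 2 + ∫ ξ : ℝ, (|2 * Real.pi * ξ| ^ s * ‖plancherel u ξ‖) ^ 2)

/-- `u ∈ Ĥ^{2-μ}(ℝ)` is a strong solution of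
`p D^{2-μ} u + q D^{(2-μ)*} u + a D u + b u = f`: the three weak derivatives exist and the
equation holds almost everywhere. -/
def IsStrongSolution (p q a b μ : ℝ) (f u : L2R) : Prop :=
  u ∈ HHat (2 - μ) ∧
    ∃ v w z : ℝ → ℝ,
      IsWeakLeftDeriv (2 - μ) u v ∧ IsWeakRightDeriv (2 - μ) u w ∧ IsWeakDeriv u z ∧
        ∀ᵐ x : ℝ, p * v x + q * w x + a * z x + b * u x = f x

/-- The exponents `σ₁, …, σ₅` (other indices are not used). -/
def sig (μ : ℝ) : ℕ → ℝ
  | 1 => 2 - μ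
  | 2 => (3 - μ) / 2
  | 3 => 1
  | 4 => (2 - μ) / 2
  | _ => 0

/-- The constants `C₁, …, C₅` (other indices are not used). -/
def coef (p q a b μ : ℝ) : ℕ → ℝ
  | 1 => p ^ 2 + q ^ 2 + 2 * p * q * Real.cos (sig μ 1 * Real.pi)
  | 2 => 2 * a * (q - p) * Real.cos (sig μ 2 * Real.pi)
  | 3 => a ^ 2
  | 4 => 2 * b * (p + q) * Real.cos (sig μ 4 * Real.pi)
  | 5 => b ^ 2
  | _ => 0

/-- Case (i). -/
def CaseI (p q a b μ : ℝ) : Prop :=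
  0 ≤ coef p q a b μ 2 ∧ 0 ≤ coef p q a b μ 4

/-- Case (ii), with scaling parameter `α`. -/
def CaseII (p q a b μ α : ℝ) : Prop :=
  0 ≤ coef p q a b μ 2 ∧ coef p q a b μ 4 < 0 ∧
    -coef p q a b μ 4 * α ^ (2 * (sig μ 5 - sig μ 4)) < b ^ 2 ∧
    0 < ∑ j ∈ Finset.Icc 1 4, coef p q a b μ j / α ^ (2 * sig μ j - 1)

/-- Case (iii), with scaling parameter `α`. -/
def CaseIII (p q a b μ α : ℝ) : Prop :=
  coef p q a b μ 2 < 0 ∧ 0 ≤ coef p q a b μ 4 ∧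
    -∑ j ∈ Finset.Icc 2 4, coef p q a b μ j * α ^ (2 * (sig μ 5 - sig μ j)) < b ^ 2 ∧
    0 < ∑ j ∈ Finset.Icc 1 2, coef p q a b μ j / α ^ (2 * sig μ j - 1)

/-- Case (iv), with scaling parameter `α`. -/
def CaseIV (p q a b μ α : ℝ) : Prop :=
  coef p q a b μ 2 < 0 ∧ coef p q a b μ 4 < 0 ∧
    -∑ j ∈ ({2, 4} : Finset ℕ), coef p q a b μ j * α ^ (2 * (sig μ 5 - sig μ j)) < b ^ 2 ∧
    0 < ∑ j ∈ ({1, 2, 4} : Finset ℕ), coef p q a b μ j / α ^ (2 * sig μ j - 1)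

end FracODE

end

/-!
The theorem holds because the operator is a Fourier multiplier whose symbol
`P(ξ) = p (2πiξ)^{2-μ} + q (-2πiξ)^{2-μ} + a (2πiξ) + b` satisfies
`|P(ξ)|² ≥ c (1 + |2πξ|^{2(2-μ)})`. The equation `Lu = f` then reads `P û = f̂`, its only solution
is `û = f̂ / P`, and the lower bound gives both `u ∈ Ĥ^{2-μ}` and the estimate. The quotient is the
transform of a real function because `P(-ξ)` is the conjugate of `P(ξ)` (`exists_plancherel_eq`).

The lower bound is elementary: `|P(ξ)|² = ∑ C_j |2πξ|^{2σ_j}` (`norm_opSymb_sq`), each of the four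
cases makes this sum positive (`energy_pos`), and its growth is governed by `C₁ > 0`
(`exists_le_energy`).

The analytic part is to identify weak fractional derivatives with multipliers. For a test function
`ψ` the derivative `D^{2-μ} ψ` is the fractional integral of order `μ` of `ψ''`, whose kernel
`r^{μ-1}` is not integrable at infinity. Damped by `e^{-εr}`, the kernel has the transform
`Γ(μ) (ε + 2πiξ)^{-μ}` (`laplace_rpow`), and letting `ε → 0` shows that `D^{2-μ} ψ` is pointwise
the inverse transform of `(2πiξ)^{2-μ} ψ̂` (`leftDeriv_eq_fourierInv`), a function in `L¹ ∩ L²`.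
Reflection gives the right derivative. Parseval's identity then turns multiplication of `û` by the
symbols into weak derivatives of `u`, and weak derivatives are unique, so strong solutions are
exactly the solutions of `P û = f̂` in `Ĥ^{2-μ}` (`isStrongSolution_iff`).
-/

noncomputable section

namespace FracODE

open ComplexConjugate Filter Topology

/-! ### The Plancherel transform of real functions -/

/-- On `L¹ ∩ L²` the inverse transform of the space `L²` is the inverse Fourier integral: both
define the same tempered distribution. -/
theorem fourierInv_toLp_ae {h : ℝ → ℂ} (h1 : Integrable h) (h2 : MemLp h 2) :
    (𝓕⁻ (h2.toLp h) : Lp ℂ 2 (volume : Measure ℝ)) =ᵐ[volume] (𝓕⁻ h : ℝ → ℂ) := by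
  have hcont : Continuous (𝓕⁻ h : ℝ → ℂ) := by
    have : (𝓕⁻ h : ℝ → ℂ) = fun x => 𝓕 h (-x) := by
      ext x; exact Real.fourierInv_eq_fourier_neg h x
    rw [this]
    exact (VectorFourier.fourierIntegral_continuous Real.continuous_fourierChar
      (L := innerₗ ℝ) continuous_inner h1).comp continuous_neg
  refine ae_eq_of_integral_contDiff_smul_eq ((Lp.memLp _).locallyIntegrable (by norm_num))
    hcont.locallyIntegrable fun g hg hgc => ?_
  have hg₁ : HasCompactSupport (Complex.ofRealCLM ∘ g) := hgc.comp_left rfl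
  have hg₂ : ContDiff ℝ (⊤ : ℕ∞) (Complex.ofRealCLM ∘ g) := by fun_prop
  set G : SchwartzMap ℝ ℂ := hg₁.toSchwartzMap hg₂
  have e1 := congrArg (fun T : TemperedDistribution ℝ ℂ => T G)
    (Lp.fourierInv_toTemperedDistribution_eq (h2.toLp h))
  simp only [TemperedDistribution.fourierInv_apply, Lp.toTemperedDistribution_apply] at e1
  have e2 : ∫ x, g x • (𝓕⁻ (h2.toLp h) : Lp ℂ 2 (volume : Measure ℝ)) x
      = ∫ x, (𝓕⁻ G) x • h x := by
    refine Eq.trans ?_ (e1.symm.trans (integral_congr_ae ?_))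
    · rfl
    · filter_upwards [h2.coeFn_toLp] with x hx
      rw [hx]
  rw [e2]
  have e3 : ∫ x, (𝓕⁻ G) x • h x = ∫ x, 𝓕 G x • h (-x) := by
    rw [← integral_neg_eq_self]
    congr 1; ext x
    rw [SchwartzMap.fourierInv_coe, Real.fourierInv_eq_fourier_neg, neg_neg, SchwartzMap.fourier_coe]
  have e4 : ∫ x, 𝓕 G x • h (-x) = ∫ x, G x • 𝓕 (fun y => h (-y)) x := by
    simpa using! VectorFourier.integral_fourierIntegral_smul_eq_flip (L := innerₗ ℝ)
      Real.continuous_fourierChar continuous_inner G.integrable h1.comp_neg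
  rw [e3, e4]
  congr 1; ext x
  rw [Real.fourierInv_eq_fourier_comp_neg]
  rfl

/-- Complex conjugation on `L²(ℝ; ℂ)`, as a real-linear map. -/
def conjLp : Lp ℂ 2 (volume : Measure ℝ) →L[ℝ] Lp ℂ 2 (volume : Measure ℝ) :=
  (Complex.conjCLE : ℂ →L[ℝ] ℂ).compLpL 2 volume

theorem coeFn_conjLp (f : Lp ℂ 2 (volume : Measure ℝ)) :
    conjLp f =ᵐ[volume] fun x => conj (f x) :=
  (Complex.conjCLE : ℂ →L[ℝ] ℂ).coeFn_compLpL f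

/-- The transform of `conj f` is `ξ ↦ conj (f̂ (-ξ))`: checked on Schwartz functions, extended by
density. -/
theorem fourier_conjLp (f : Lp ℂ 2 (volume : Measure ℝ)) :
    𝓕 (conjLp f) = Lp.compMeasurePreserving (fun x : ℝ => -x)
      (Measure.measurePreserving_neg volume) (conjLp (𝓕 f)) := by
  apply DenseRange.induction_on (p := fun f => 𝓕 (conjLp f) =
      Lp.compMeasurePreserving (fun x : ℝ => -x)
      (Measure.measurePreserving_neg volume) (conjLp (𝓕 f)))
    (SchwartzMap.denseRange_toLpCLM (p := 2) ENNReal.ofNat_ne_top) f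
  · apply isClosed_eq
    · exact (Lp.fourierTransformₗᵢ ℝ ℂ).continuous.comp conjLp.continuous
    · exact (Lp.isometry_compMeasurePreserving _).continuous.comp
        (conjLp.continuous.comp (Lp.fourierTransformₗᵢ ℝ ℂ).continuous)
  · intro g
    have e1 : conjLp (g.toLp 2) =
        (SchwartzMap.postcompCLM (Complex.conjCLE : ℂ →L[ℝ] ℂ) g).toLp 2 := by
      apply Lp.ext
      filter_upwards [coeFn_conjLp (g.toLp 2), g.coeFn_toLp 2 volume,
        (SchwartzMap.postcompCLM (Complex.conjCLE : ℂ →L[ℝ] ℂ) g).coeFn_toLp 2 volume]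
        with x h1 h2 h3
      rw [h1, h2, h3]; rfl
    rw [SchwartzMap.toLpCLM_apply, e1, SchwartzMap.toLp_fourier_eq, SchwartzMap.toLp_fourier_eq]
    apply Lp.ext
    have h4 := (Measure.measurePreserving_neg (volume : Measure ℝ)).quasiMeasurePreserving.ae
      ((coeFn_conjLp ((𝓕 g).toLp 2)).and ((𝓕 g).coeFn_toLp 2 volume))
    filter_upwards [Lp.coeFn_compMeasurePreserving (conjLp ((𝓕 g).toLp 2))
      (Measure.measurePreserving_neg (volume : Measure ℝ)), h4,
      (𝓕 (SchwartzMap.postcompCLM (Complex.conjCLE : ℂ →L[ℝ] ℂ) g)).coeFn_toLp 2 volume]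
      with x h1 h2 h3
    rw [h1, Function.comp_apply, h2.1, h2.2, h3, SchwartzMap.fourier_coe, SchwartzMap.fourier_coe,
      Real.fourier_eq', Real.fourier_eq', ← integral_conj]
    congr 1; ext y
    simp [← Complex.exp_conj, Complex.conj_ofNat]

theorem coeFn_fourier_conjLp (f : Lp ℂ 2 (volume : Measure ℝ)) :
    (𝓕 (conjLp f) : Lp ℂ 2 (volume : Measure ℝ)) =ᵐ[volume]
      fun ξ => conj ((𝓕 f : Lp ℂ 2 (volume : Measure ℝ)) (-ξ)) := by
  rw [fourier_conjLp]
  filter_upwards [Lp.coeFn_compMeasurePreserving (conjLp (𝓕 f))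
      (Measure.measurePreserving_neg (volume : Measure ℝ)),
    (Measure.measurePreserving_neg (volume : Measure ℝ)).quasiMeasurePreserving.ae
      (coeFn_conjLp (𝓕 f))] with x h1 h2
  rw [h1, Function.comp_apply, h2]

theorem coeFn_ofRealLp (u : L2R) :
    (Complex.ofRealCLM.compLp u) =ᵐ[volume] fun x => (u x : ℂ) :=
  Complex.ofRealCLM.coeFn_compLp u

theorem plancherel_neg (u : L2R) : ∀ᵐ ξ, plancherel u (-ξ) = conj (plancherel u ξ) := by
  have h : conjLp (Complex.ofRealCLM.compLp u) = Complex.ofRealCLM.compLp u := by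
    apply Lp.ext
    filter_upwards [coeFn_conjLp (Complex.ofRealCLM.compLp u), coeFn_ofRealLp u] with x h1 h2
    rw [h1, h2, Complex.conj_ofReal]
  have := coeFn_fourier_conjLp (Complex.ofRealCLM.compLp u)
  rw [h] at this
  filter_upwards [this] with x hx
  rw [plancherel, hx, Complex.conj_conj]

/-- Every square integrable Hermitian function is the transform of a real function. -/
theorem exists_plancherel_eq {h : ℝ → ℂ} (h2 : MemLp h 2)
    (hh : ∀ᵐ ξ, h (-ξ) = conj (h ξ)) : ∃ v : L2R, plancherel v =ᵐ[volume] h := by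
  set V : Lp ℂ 2 (volume : Measure ℝ) := 𝓕⁻ (h2.toLp h) with hV
  have hFV : 𝓕 V = h2.toLp h := FourierTransform.fourier_fourierInv_eq _
  -- the Hermitian symmetry of `h` says that `V` is real
  have hc : conjLp V = V := by
    apply (Lp.fourierTransformₗᵢ ℝ ℂ).injective
    change 𝓕 (conjLp V) = 𝓕 V
    apply Lp.ext
    filter_upwards [coeFn_fourier_conjLp V, hh, h2.coeFn_toLp,
      (Measure.measurePreserving_neg (volume : Measure ℝ)).quasiMeasurePreserving.ae
        h2.coeFn_toLp] with x h1 h3 h4 h5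
    rw [h1, hFV, h5, h4, h3, Complex.conj_conj]
  refine ⟨Complex.reCLM.compLp V, ?_⟩
  have : Complex.ofRealCLM.compLp (Complex.reCLM.compLp V) = V := by
    apply Lp.ext
    filter_upwards [coeFn_ofRealLp (Complex.reCLM.compLp V), Complex.reCLM.coeFn_compLp V,
      coeFn_conjLp V] with x h1 h3 h4
    rw [hc] at h4
    rw [h1, h3]
    exact Complex.conj_eq_iff_re.1 h4.symm
  rw [plancherel, this, hFV]
  exact h2.coeFn_toLp

theorem plancherel_sub (u v : L2R) : plancherel (u - v) = plancherel u - plancherel v := by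
  have : Complex.ofRealCLM.compLp (u - v) =
      Complex.ofRealCLM.compLp u - Complex.ofRealCLM.compLp v :=
    (Complex.ofRealCLM.compLpL 2 (volume : Measure ℝ)).map_sub u v
  rw [plancherel, this]
  exact (Lp.fourierTransformₗᵢ ℝ ℂ).map_sub _ _

theorem plancherel_add (u v : L2R) : plancherel (u + v) = plancherel u + plancherel v := by
  have : Complex.ofRealCLM.compLp (u + v) =
      Complex.ofRealCLM.compLp u + Complex.ofRealCLM.compLp v :=
    (Complex.ofRealCLM.compLpL 2 (volume : Measure ℝ)).map_add u v
  rw [plancherel, this]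
  exact (Lp.fourierTransformₗᵢ ℝ ℂ).map_add _ _

theorem plancherel_smul (c : ℝ) (u : L2R) : plancherel (c • u) = (c : ℂ) • plancherel u := by
  have : Complex.ofRealCLM.compLp (c • u) = (c : ℂ) • Complex.ofRealCLM.compLp u := by
    apply Lp.ext
    filter_upwards [coeFn_ofRealLp (c • u), Lp.coeFn_smul c u, coeFn_ofRealLp u,
      Lp.coeFn_smul (c : ℂ) (Complex.ofRealCLM.compLp u)] with x h1 h2 h3 h4
    rw [h1, h2, h4, Pi.smul_apply, Pi.smul_apply, h3]
    simp
  rw [plancherel, this]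
  exact (Lp.fourierTransformₗᵢ ℝ ℂ).map_smul _ _

theorem norm_plancherel (u : L2R) : ‖plancherel u‖ = ‖u‖ := by
  rw [plancherel, Lp.norm_fourier_eq, Lp.norm_def, Lp.norm_def]
  congr 1
  rw [eLpNorm_congr_ae (coeFn_ofRealLp u)]
  exact eLpNorm_congr_norm_ae (by simp)

theorem plancherel_injective : Function.Injective plancherel := by
  intro u v h
  rw [← sub_eq_zero, ← norm_eq_zero, ← norm_plancherel, plancherel_sub, h, sub_self, norm_zero]

/-- Parseval's identity for real functions. -/
theorem integral_mul_eq_plancherel (u g : L2R) :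
    ((∫ x, u x * g x : ℝ) : ℂ) = ∫ ξ, plancherel u ξ * conj (plancherel g ξ) := by
  have h := Lp.inner_fourier_eq (Complex.ofRealCLM.compLp g) (Complex.ofRealCLM.compLp u)
  rw [L2.inner_def, L2.inner_def] at h
  simp only [RCLike.inner_apply] at h
  change _ = ∫ ξ, (𝓕 (Complex.ofRealCLM.compLp u) : Lp ℂ 2 (volume : Measure ℝ)) ξ * conj
    ((𝓕 (Complex.ofRealCLM.compLp g) : Lp ℂ 2 (volume : Measure ℝ)) ξ)
  rw [h]
  refine integral_ofReal.symm.trans (integral_congr_ae ?_)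
  filter_upwards [coeFn_ofRealLp u, coeFn_ofRealLp g] with x h1 h2
  rw [h1, h2]; simp

theorem norm_sq_eq_integral (u : L2R) : ‖u‖ ^ 2 = ∫ ξ, ‖plancherel u ξ‖ ^ 2 := by
  have h := integral_mul_eq_plancherel u u
  have h2 : ((∫ x, u x * u x : ℝ) : ℂ) = ((∫ ξ, ‖plancherel u ξ‖ ^ 2 : ℝ) : ℂ) := by
    rw [h]
    refine Eq.trans ?_ integral_ofReal
    congr 1; ext ξ
    rw [Complex.mul_conj']; simp
  rw [← real_inner_self_eq_norm_sq, L2.inner_def, ← Complex.ofReal_injective h2]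
  simp [pow_two]

/-! ### Riemann–Liouville derivatives of test functions -/

theorem IsTest.deriv {ψ : ℝ → ℝ} (h : IsTest ψ) : IsTest (deriv ψ) :=
  ⟨(contDiff_infty_iff_deriv.1 h.1).2, h.2.deriv⟩

theorem IsTest.comp_neg {ψ : ℝ → ℝ} (h : IsTest ψ) : IsTest (fun x => ψ (-x)) :=
  ⟨h.1.comp contDiff_neg, h.2.comp_homeomorph (Homeomorph.neg ℝ)⟩

/-- A test function, regarded as a complex-valued Schwartz function. -/
def IsTest.toSchwartz {ψ : ℝ → ℝ} (h : IsTest ψ) : SchwartzMap ℝ ℂ :=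
  HasCompactSupport.toSchwartzMap (f := fun x => (ψ x : ℂ))
    (h.2.comp_left (g := fun y : ℝ => (y : ℂ)) rfl) (Complex.ofRealCLM.contDiff.comp h.1)

theorem IsTest.fourier_deriv {ψ : ℝ → ℝ} (h : IsTest ψ) (ξ : ℝ) :
    𝓕 h.deriv.toSchwartz ξ = ((2 * Real.pi * ξ : ℝ) * Complex.I : ℂ) * 𝓕 h.toSchwartz ξ := by
  have e : (⇑h.deriv.toSchwartz : ℝ → ℂ) = _root_.deriv (⇑h.toSchwartz) := by
    ext x
    have : HasDerivAt (fun x => (ψ x : ℂ)) ((_root_.deriv ψ x : ℝ) : ℂ) x :=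
      ((h.1.differentiable (by simp)) x).hasDerivAt.ofReal_comp
    exact this.deriv.symm
  rw [SchwartzMap.fourier_coe, SchwartzMap.fourier_coe, e,
    Real.fourier_deriv h.toSchwartz.integrable h.toSchwartz.differentiable
      (by rw [← e]; exact h.deriv.toSchwartz.integrable)]
  simp only [smul_eq_mul]
  push_cast
  ring

theorem IsTest.fourier_comp_neg {ψ : ℝ → ℝ} (h : IsTest ψ) (ξ : ℝ) :
    𝓕 h.comp_neg.toSchwartz ξ = 𝓕 h.toSchwartz (-ξ) := by
  rw [SchwartzMap.fourier_coe, SchwartzMap.fourier_coe, ← Real.fourierInv_eq_fourier_neg,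
    Real.fourierInv_eq_fourier_comp_neg]
  rfl

theorem leftIntegral_eq (σ : ℝ) (w : ℝ → ℝ) (x : ℝ) :
    leftIntegral σ w x = 1 / Real.Gamma σ * ∫ r in Set.Ioi 0, r ^ (σ - 1) * w (x - r) := by
  rw [leftIntegral, ← integral_indicator measurableSet_Iio, ← integral_indicator measurableSet_Ioi,
    ← integral_sub_left_eq_self _ volume x]
  congr 2; ext r
  by_cases hr : 0 < r
  · rw [Set.indicator_of_mem (by simpa using hr), Set.indicator_of_mem (by simpa using hr)]
    simp
  · rw [Set.indicator_of_notMem (by simpa using hr), Set.indicator_of_notMem (by simpa using hr)]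

theorem locallyIntegrable_kernel {σ : ℝ} (hσ : 0 < σ) :
    LocallyIntegrable ((Set.Ioi (0 : ℝ)).indicator fun r : ℝ => r ^ (σ - 1)) := by
  have h1 : Integrable ((Set.Ioi (0 : ℝ)).indicator fun r : ℝ => Real.exp (-r) * r ^ (σ - 1)) :=
    (integrable_indicator_iff measurableSet_Ioi).2 (Real.GammaIntegral_convergent hσ)
  have h2 := h1.locallyIntegrable.continuous_mul Real.continuous_exp
  refine h2.congr (ae_of_all _ fun r => ?_)
  by_cases hr : r ∈ Set.Ioi (0 : ℝ)
  · simp only [Set.indicator_of_mem hr]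
    rw [← mul_assoc, ← Real.exp_add]; simp
  · simp only [Set.indicator_of_notMem hr, mul_zero]

theorem leftIntegral_eq_convolution (σ : ℝ) (w : ℝ → ℝ) :
    leftIntegral σ w = fun x => 1 / Real.Gamma σ *
      convolution ((Set.Ioi (0 : ℝ)).indicator fun r : ℝ => r ^ (σ - 1)) w
        (ContinuousLinearMap.mul ℝ ℝ) volume x := by
  ext x
  rw [leftIntegral_eq, ← integral_indicator measurableSet_Ioi, convolution]
  congr 2; ext r
  by_cases hr : r ∈ Set.Ioi (0 : ℝ)
  · simp only [Set.indicator_of_mem hr, ContinuousLinearMap.mul_apply']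
  · simp only [Set.indicator_of_notMem hr, ContinuousLinearMap.mul_apply', zero_mul]

/-- The fractional integral commutes with differentiation on test functions. -/
theorem deriv_leftIntegral {σ : ℝ} (hσ : 0 < σ) {ψ : ℝ → ℝ} (h : IsTest ψ) :
    deriv (leftIntegral σ ψ) = leftIntegral σ (deriv ψ) := by
  ext x
  rw [leftIntegral_eq_convolution, leftIntegral_eq_convolution]
  exact ((h.2.hasDerivAt_convolution_right (ContinuousLinearMap.mul ℝ ℝ)
    (locallyIntegrable_kernel hσ) (h.1.of_le (by simp)) x).const_mul _).deriv

theorem rlOrder_two_sub {μ : ℝ} (hμ0 : 0 < μ) (hμ1 : μ < 1) : rlOrder (2 - μ) = 2 := by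
  have : ⌊2 - μ⌋₊ = 1 := (Nat.floor_eq_iff (by linarith)).2 ⟨by push_cast; linarith,
    by push_cast; linarith⟩
  rw [rlOrder, this]

theorem leftDeriv_eq {μ : ℝ} (hμ0 : 0 < μ) (hμ1 : μ < 1) {ψ : ℝ → ℝ} (h : IsTest ψ) :
    leftDeriv (2 - μ) ψ = leftIntegral μ (deriv (deriv ψ)) := by
  rw [leftDeriv, rlOrder_two_sub hμ0 hμ1, iteratedDeriv_succ, iteratedDeriv_one]
  rw [show ((2 : ℕ) : ℝ) - (2 - μ) = μ by push_cast; ring, deriv_leftIntegral hμ0 h,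
    deriv_leftIntegral hμ0 h.deriv]

theorem rightIntegral_eq (σ : ℝ) (w : ℝ → ℝ) :
    rightIntegral σ w = fun x => leftIntegral σ (fun y => w (-y)) (-x) := by
  ext x
  rw [leftIntegral_eq, rightIntegral, ← integral_indicator measurableSet_Ioi,
    ← integral_indicator measurableSet_Ioi, ← integral_add_right_eq_self _ x]
  congr 2; ext r
  by_cases hr : 0 < r
  · rw [Set.indicator_of_mem (by simpa using hr), Set.indicator_of_mem (by simpa using hr)]
    simp [add_comm]
  · rw [Set.indicator_of_notMem (by simpa using hr), Set.indicator_of_notMem (by simpa using hr)]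

theorem rightDeriv_eq {μ : ℝ} (hμ0 : 0 < μ) (hμ1 : μ < 1) (ψ : ℝ → ℝ) (x : ℝ) :
    rightDeriv (2 - μ) ψ x = leftDeriv (2 - μ) (fun y => ψ (-y)) (-x) := by
  rw [rightDeriv, leftDeriv, rlOrder_two_sub hμ0 hμ1, rightIntegral_eq, iteratedDeriv_comp_neg]
  simp

/-! ### Fractional derivatives of test functions as Fourier multipliers -/

/-- The symbol `(2πiξ)^s` of the left derivative of order `s`, with the principal branch of the
power; the symbol of the right derivative is its complex conjugate. -/
def symb (s ξ : ℝ) : ℂ := ((2 * Real.pi * ξ : ℝ) * Complex.I : ℂ) ^ (s : ℂ)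

theorem norm_symb (s ξ : ℝ) : ‖symb s ξ‖ = |2 * Real.pi * ξ| ^ s := by
  rw [symb, Complex.norm_cpow_real]
  simp

theorem symb_neg (s ξ : ℝ) : symb s (-ξ) = conj (symb s ξ) := by
  -- at `ξ = 0` both sides are values of `0 ^ s`
  rcases eq_or_ne ξ 0 with rfl | hξ
  · rcases eq_or_ne s 0 with rfl | hs
    · simp [symb]
    · simp [symb, Complex.zero_cpow (Complex.ofReal_ne_zero.2 hs)]
  · have e : ((2 * Real.pi * -ξ : ℝ) * Complex.I : ℂ) =
        conj ((2 * Real.pi * ξ : ℝ) * Complex.I : ℂ) := by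
      rw [map_mul, Complex.conj_ofReal, Complex.conj_I]
      push_cast
      ring
    rw [symb, symb, e, Complex.conj_cpow, Complex.conj_ofReal]
    rw [Ne, Complex.arg_eq_pi_iff]
    simp [hξ, Real.pi_ne_zero]

theorem measurable_symb (s : ℝ) : Measurable (symb s) := by
  unfold symb
  fun_prop

theorem integrableOn_kernel_mul_exp {σ ε : ℝ} (hσ : 0 < σ) (hε : 0 < ε) :
    IntegrableOn (fun r : ℝ => r ^ (σ - 1) * Real.exp (-(ε * r))) (Set.Ioi 0) := by
  have := integrableOn_rpow_mul_exp_neg_mul_rpow (p := 1) (s := σ - 1) (b := ε) (by linarith)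
    one_pos hε
  simpa using this

/-- The Laplace transform of `r^{σ-1}` on the right half plane, by analytic continuation from the
positive reals. -/
theorem laplace_rpow {σ : ℝ} (hσ : 0 < σ) {z : ℂ} (hz : 0 < z.re) :
    ∫ r in Set.Ioi (0 : ℝ), ((r ^ (σ - 1) : ℝ) : ℂ) * Complex.exp (-(z * r)) =
    (1 / z) ^ (σ : ℂ) * Real.Gamma σ := by
  set U : Set ℂ := {z | 0 < z.re} with hU
  have hUo : IsOpen U := isOpen_lt continuous_const Complex.continuous_re
  have hUc : IsPreconnected U := (convex_halfSpace_re_gt 0).isPreconnected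
  have hmeas : ∀ (τ : ℝ) (z : ℂ), AEStronglyMeasurable
      (fun r : ℝ => ((r ^ τ : ℝ) : ℂ) * Complex.exp (-(z * r)))
      (volume.restrict (Set.Ioi 0)) := fun τ z => by
    refine Measurable.aestronglyMeasurable ?_
    fun_prop
  have hnorm : ∀ (τ : ℝ) (z : ℂ) (r : ℝ), 0 < r →
      ‖((r ^ τ : ℝ) : ℂ) * Complex.exp (-(z * r))‖ = r ^ τ * Real.exp (-(z.re * r)) := by
    intro τ z r hr
    rw [norm_mul, Complex.norm_real, Complex.norm_exp,
      Real.norm_of_nonneg (Real.rpow_nonneg hr.le _)]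
    simp
  have hF : DifferentiableOn ℂ
      (fun z => ∫ r in Set.Ioi (0 : ℝ), ((r ^ (σ - 1) : ℝ) : ℂ) * Complex.exp (-(z * r))) U := by
    intro z hz
    have hz' : 0 < z.re := hz
    refine (hasDerivAt_integral_of_dominated_loc_of_deriv_le (𝕜 := ℂ)
      (F' := fun z (r : ℝ) => ((r ^ (σ - 1) : ℝ) : ℂ) * (Complex.exp (-(z * r)) * (-r)))
      (bound := fun r => r ^ ((σ + 1) - 1) * Real.exp (-(z.re / 2 * r)))
      (Metric.ball_mem_nhds z (half_pos hz')) ?_ ?_ ?_ ?_ ?_ ?_).2.differentiableAt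
        |>.differentiableWithinAt
    · exact Eventually.of_forall fun w => hmeas _ w
    · refine (integrableOn_kernel_mul_exp hσ hz').mono' (hmeas _ _) ?_
      filter_upwards [ae_restrict_mem measurableSet_Ioi] with r hr
      exact (hnorm _ _ _ hr).le
    · refine Measurable.aestronglyMeasurable ?_
      fun_prop
    · filter_upwards [ae_restrict_mem measurableSet_Ioi] with r hr w hw
      have hr' : (0 : ℝ) < r := hr
      have hw' : z.re / 2 ≤ w.re := by
        have := (Complex.abs_re_le_norm (w - z)).trans (mem_ball_iff_norm.1 hw).le
        rw [Complex.sub_re, abs_le] at this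
        linarith
      rw [← mul_assoc, norm_mul, hnorm _ _ _ hr', norm_neg, Complex.norm_real,
        Real.norm_of_nonneg hr'.le, show σ + 1 - 1 = (σ - 1) + 1 by ring,
        Real.rpow_add_one hr'.ne']
      calc _ = r ^ (σ - 1) * r * Real.exp (-(w.re * r)) := by ring
        _ ≤ _ := by gcongr
    · exact integrableOn_kernel_mul_exp (by linarith) (half_pos hz')
    · refine ae_of_all _ fun r w _ => ?_
      have := (((hasDerivAt_id w).mul_const (r : ℂ)).neg).cexp.const_mul ((r ^ (σ - 1) : ℝ) : ℂ)
      simpa using this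
  have hG : DifferentiableOn ℂ (fun z : ℂ => (1 / z) ^ (σ : ℂ) * Real.Gamma σ) U := by
    intro z hz
    have hz0 : z ≠ 0 := by rintro rfl; simp [hU] at hz
    have hs : (1 / z) ∈ Complex.slitPlane := by
      left
      rw [one_div, Complex.inv_re]
      exact div_pos hz (Complex.normSq_pos.2 hz0)
    exact (((differentiableAt_const _).div differentiableAt_id hz0).cpow_const
      hs).mul_const _ |>.differentiableWithinAt
  refine (hF.analyticOnNhd hUo).eqOn_of_preconnected_of_frequently_eq (hG.analyticOnNhd hUo)
    hUc (z₀ := 1) (by simp [hU]) ?_ hz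
  have ht : Tendsto (fun r : ℝ => (r : ℂ)) (𝓝[≠] 1) (𝓝[≠] 1) := by
    refine tendsto_nhdsWithin_iff.2 ⟨?_, ?_⟩
    · exact (Complex.continuous_ofReal.tendsto' 1 1 (by simp)).mono_left nhdsWithin_le_nhds
    · filter_upwards [self_mem_nhdsWithin] with r hr
      simpa using hr
  refine ht.frequently (Eventually.frequently ?_)
  filter_upwards [mem_nhdsWithin_of_mem_nhds (Ioi_mem_nhds (zero_lt_one (α := ℝ)))] with x hx
  have := Complex.integral_cpow_mul_exp_neg_mul_Ioi (a := σ) (by simpa using hσ) hx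
  rw [Complex.Gamma_ofReal] at this
  rw [← this]
  refine setIntegral_congr_fun measurableSet_Ioi fun r hr => ?_
  have hr' : (0 : ℝ) < r := hr
  rw [Complex.ofReal_cpow hr'.le]
  push_cast
  rfl

/-- The Laplace–Fourier transform of the kernel `r^{σ-1}`, damped by `e^{-εr}`. -/
theorem integral_kernel_mul_exp {σ ε : ℝ} (hσ : 0 < σ) (hε : 0 < ε) (ξ : ℝ) :
    ∫ r in Set.Ioi (0 : ℝ), ((r ^ (σ - 1) * Real.exp (-(ε * r)) : ℝ) : ℂ) *
      Complex.exp ((-(2 * Real.pi * ξ * r) : ℝ) * Complex.I) =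
    (1 / (ε + (2 * Real.pi * ξ : ℝ) * Complex.I)) ^ (σ : ℂ) * Real.Gamma σ := by
  rw [← laplace_rpow hσ (by simpa using hε)]
  congr 1; ext r
  rw [Complex.ofReal_mul, Complex.ofReal_exp, mul_assoc, ← Complex.exp_add]
  push_cast
  congr 2
  ring

/-- The damped fractional integral acts on inverse Fourier transforms as the multiplier
`(ε + 2πiξ)^{-σ}`. The damping makes the kernel integrable, so that Fubini's theorem applies. -/
theorem integral_kernel_mul_exp_mul_fourierInv {σ ε : ℝ} (hσ : 0 < σ) (hε : 0 < ε)
    {φ : ℝ → ℂ} (hφ : Integrable φ) (x : ℝ) :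
    ∫ r in Set.Ioi (0 : ℝ), ((r ^ (σ - 1) * Real.exp (-(ε * r)) : ℝ) : ℂ) * 𝓕⁻ φ (x - r) =
    Real.Gamma σ * ∫ ξ, Complex.exp ((2 * Real.pi * ξ * x : ℝ) * Complex.I) *
      ((1 / (ε + (2 * Real.pi * ξ : ℝ) * Complex.I)) ^ (σ : ℂ) * φ ξ) := by
  have hk := (integrableOn_kernel_mul_exp hσ hε).ofReal (𝕜 := ℂ)
  have e1 : ∀ r : ℝ, ((r ^ (σ - 1) * Real.exp (-(ε * r)) : ℝ) : ℂ) * 𝓕⁻ φ (x - r) =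
      ∫ ξ, ((r ^ (σ - 1) * Real.exp (-(ε * r)) : ℝ) : ℂ) * φ ξ *
        Complex.exp ((2 * Real.pi * (ξ * (x - r)) : ℝ) * Complex.I) := by
    intro r
    rw [Real.fourierInv_eq', ← integral_const_mul]
    congr 1; ext ξ
    simp only [smul_eq_mul, RCLike.inner_apply, conj_trivial]
    push_cast
    rw [mul_comm ((x : ℂ) - r)]
    ring
  simp_rw [e1]
  rw [integral_integral_swap]
  · rw [← integral_const_mul]
    congr 1; ext ξ
    have e2 : ∀ r : ℝ, ((r ^ (σ - 1) * Real.exp (-(ε * r)) : ℝ) : ℂ) * φ ξ *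
        Complex.exp ((2 * Real.pi * (ξ * (x - r)) : ℝ) * Complex.I) =
        (φ ξ * Complex.exp ((2 * Real.pi * ξ * x : ℝ) * Complex.I)) *
        (((r ^ (σ - 1) * Real.exp (-(ε * r)) : ℝ) : ℂ) *
          Complex.exp ((-(2 * Real.pi * ξ * r) : ℝ) * Complex.I)) := by
      intro r
      rw [show ((2 * Real.pi * (ξ * (x - r)) : ℝ) * Complex.I : ℂ) =
        (2 * Real.pi * ξ * x : ℝ) * Complex.I + (-(2 * Real.pi * ξ * r) : ℝ) * Complex.I by
          push_cast; ring, Complex.exp_add]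
      ring
    simp_rw [e2]
    rw [integral_const_mul, integral_kernel_mul_exp hσ hε]
    ring
  · refine (hk.mul_prod hφ).mul_bdd (c := 1) ?_ ?_
    · exact (by fun_prop : Continuous fun z : ℝ × ℝ =>
        Complex.exp ((2 * Real.pi * (z.2 * (x - z.1)) : ℝ) * Complex.I)).aestronglyMeasurable
    · exact ae_of_all _ fun z => (Complex.norm_exp_ofReal_mul_I _).le

theorem norm_symb_le {μ : ℝ} (hμ0 : 0 < μ) (hμ1 : μ < 1) (ξ : ℝ) :
    ‖symb (2 - μ) ξ‖ ≤ 1 + |2 * Real.pi * ξ| ^ 2 := by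
  rw [norm_symb]
  rcases le_total (|2 * Real.pi * ξ|) 1 with h | h
  · have := Real.rpow_le_one (abs_nonneg (2 * Real.pi * ξ)) h (by linarith : 0 ≤ 2 - μ)
    have := sq_nonneg |2 * Real.pi * ξ|
    linarith
  · have := Real.rpow_le_rpow_of_exponent_le h (by linarith : 2 - μ ≤ (2 : ℝ))
    rw [Real.rpow_two] at this
    linarith

/-- The multiplier is dominated by `1 + |2πξ|²`, which costs two derivatives of the test
function. -/
theorem symb_mul_le {μ : ℝ} (hμ0 : 0 < μ) (hμ1 : μ < 1) {ψ : ℝ → ℝ} (h : IsTest ψ) (ξ : ℝ) :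
    ‖symb (2 - μ) ξ * 𝓕 h.toSchwartz ξ‖ ≤
      ‖‖𝓕 h.toSchwartz ξ‖ + ‖𝓕 h.deriv.deriv.toSchwartz ξ‖‖ := by
  rw [h.deriv.fourier_deriv, h.fourier_deriv, norm_mul, norm_mul, norm_mul,
    Real.norm_of_nonneg (by positivity)]
  calc _ ≤ (1 + |2 * Real.pi * ξ| ^ 2) * ‖𝓕 h.toSchwartz ξ‖ := by
        gcongr; exact norm_symb_le hμ0 hμ1 ξ
    _ = _ := by simp; ring

theorem aestronglyMeasurable_symb_mul (s : ℝ) (φ : SchwartzMap ℝ ℂ) :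
    AEStronglyMeasurable (fun ξ => symb s ξ * φ ξ) :=
  (measurable_symb s).aestronglyMeasurable.mul φ.continuous.aestronglyMeasurable

theorem integrable_symb_mul {μ : ℝ} (hμ0 : 0 < μ) (hμ1 : μ < 1) {ψ : ℝ → ℝ} (h : IsTest ψ) :
    Integrable (fun ξ => symb (2 - μ) ξ * 𝓕 h.toSchwartz ξ) :=
  ((𝓕 h.toSchwartz).integrable.norm.add (𝓕 h.deriv.deriv.toSchwartz).integrable.norm).mono
    (aestronglyMeasurable_symb_mul _ _) (ae_of_all _ (symb_mul_le hμ0 hμ1 h))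

theorem memLp_symb_mul {μ : ℝ} (hμ0 : 0 < μ) (hμ1 : μ < 1) {ψ : ℝ → ℝ} (h : IsTest ψ) :
    MemLp (fun ξ => symb (2 - μ) ξ * 𝓕 h.toSchwartz ξ) 2 :=
  (((𝓕 h.toSchwartz).memLp 2).norm.add ((𝓕 h.deriv.deriv.toSchwartz).memLp 2).norm).mono
    (aestronglyMeasurable_symb_mul _ _) (ae_of_all _ (symb_mul_le hμ0 hμ1 h))

theorem integrableOn_kernel_mul {σ : ℝ} (hσ : 0 < σ) {ψ : ℝ → ℝ} (h : IsTest ψ) (x : ℝ) :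
    IntegrableOn (fun r : ℝ => r ^ (σ - 1) * ψ (x - r)) (Set.Ioi 0) := by
  rw [← integrable_indicator_iff measurableSet_Ioi]
  have h1 := (locallyIntegrable_kernel hσ).integrable_smul_left_of_hasCompactSupport
    (g := fun r => ψ (x - r)) (h.1.continuous.comp (continuous_const.sub continuous_id))
    (h.2.comp_homeomorph (Homeomorph.subLeft x))
  refine h1.congr (ae_of_all _ fun r => ?_)
  by_cases hr : r ∈ Set.Ioi (0 : ℝ)
  · simp only [Set.indicator_of_mem hr, smul_eq_mul]; ring
  · simp only [Set.indicator_of_notMem hr, smul_eq_mul, mul_zero]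

/-- Two derivatives and a fractional integral of order `μ` combine to the symbol of order
`2 - μ`. -/
theorem inv_cpow_mul_sq {μ ξ : ℝ} (hξ : ξ ≠ 0) :
    (1 / ((2 * Real.pi * ξ : ℝ) * Complex.I : ℂ)) ^ (μ : ℂ) *
      ((2 * Real.pi * ξ : ℝ) * Complex.I : ℂ) ^ 2 = symb (2 - μ) ξ := by
  have hz : ((2 * Real.pi * ξ : ℝ) * Complex.I : ℂ) ≠ 0 := by
    simp [hξ, Real.pi_ne_zero]
  rw [symb]
  push_cast at hz ⊢
  rw [Complex.cpow_sub _ _ hz, one_div, Complex.inv_cpow, div_eq_mul_inv, mul_comm]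
  · norm_cast
  · rw [Ne, Complex.arg_eq_pi_iff]
    simp [hξ, Real.pi_ne_zero]

/-- On test functions the left derivative of order `2 - μ` is the Fourier multiplier
`(2πiξ)^(2-μ)`; the damping of the kernel is removed by dominated convergence on both sides. -/
theorem leftDeriv_eq_fourierInv {μ : ℝ} (hμ0 : 0 < μ) (hμ1 : μ < 1) {ψ : ℝ → ℝ} (h : IsTest ψ)
    (x : ℝ) : (leftDeriv (2 - μ) ψ x : ℂ) =
      𝓕⁻ (fun ξ => symb (2 - μ) ξ * 𝓕 h.toSchwartz ξ) x := by
  set φ : SchwartzMap ℝ ℂ := 𝓕 h.deriv.deriv.toSchwartz with hφ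
  have hφξ : ∀ ξ, φ ξ = ((2 * Real.pi * ξ : ℝ) * Complex.I : ℂ) ^ 2 * 𝓕 h.toSchwartz ξ := by
    intro ξ
    rw [hφ, h.deriv.fourier_deriv, h.fourier_deriv]
    ring
  have hinv : ∀ y, 𝓕⁻ (φ : ℝ → ℂ) y = ((deriv (deriv ψ) y : ℝ) : ℂ) := by
    intro y
    rw [← SchwartzMap.fourierInv_coe, hφ, FourierTransform.fourierInv_fourier_eq]
    rfl
  have hA : Tendsto (fun ε : ℝ => ∫ r in Set.Ioi (0 : ℝ),
      ((r ^ (μ - 1) * Real.exp (-(ε * r)) : ℝ) : ℂ) * 𝓕⁻ (φ : ℝ → ℂ) (x - r)) (𝓝[>] 0)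
      (𝓝 (∫ r in Set.Ioi (0 : ℝ), ((r ^ (μ - 1) * deriv (deriv ψ) (x - r) : ℝ) : ℂ))) := by
    have hcont := h.deriv.deriv.1.continuous
    refine tendsto_integral_filter_of_dominated_convergence
      (fun r => ‖r ^ (μ - 1) * deriv (deriv ψ) (x - r)‖) ?_ ?_ ?_ ?_
    · refine Eventually.of_forall fun ε => Measurable.aestronglyMeasurable ?_
      simp_rw [hinv]
      fun_prop
    · filter_upwards [self_mem_nhdsWithin] with ε hε
      filter_upwards [ae_restrict_mem measurableSet_Ioi] with r hr
      have hr' : (0 : ℝ) < r := hr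
      have hε' : (0 : ℝ) < ε := hε
      rw [hinv, ← Complex.ofReal_mul, Complex.norm_real, norm_mul, norm_mul, norm_mul]
      gcongr
      rw [Real.norm_of_nonneg (Real.exp_pos _).le]
      refine mul_le_of_le_one_right (norm_nonneg _) (Real.exp_le_one_iff.2 ?_)
      have := mul_pos hε' hr'
      linarith
    · exact (integrableOn_kernel_mul hμ0 h.deriv.deriv x).norm
    · refine ae_of_all _ fun r => ?_
      simp_rw [hinv, ← Complex.ofReal_mul]
      have : Continuous fun ε : ℝ =>
          ((r ^ (μ - 1) * Real.exp (-(ε * r)) * deriv (deriv ψ) (x - r) : ℝ) : ℂ) := by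
        fun_prop
      exact (this.tendsto' 0 _ (by simp)).mono_left nhdsWithin_le_nhds
  -- on the Fourier side the integrand is dominated by its limit, as `|ε + iτ| ≥ |iτ|`
  have hB : Tendsto (fun ε : ℝ => Real.Gamma μ * ∫ ξ : ℝ,
      Complex.exp ((2 * Real.pi * ξ * x : ℝ) * Complex.I) *
      ((1 / (ε + (2 * Real.pi * ξ : ℝ) * Complex.I)) ^ (μ : ℂ) * φ ξ)) (𝓝[>] 0)
      (𝓝 (Real.Gamma μ * ∫ ξ : ℝ, Complex.exp ((2 * Real.pi * ξ * x : ℝ) * Complex.I) *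
        (symb (2 - μ) ξ * 𝓕 h.toSchwartz ξ))) := by
    refine Tendsto.const_mul _ ?_
    have hne : ∀ᵐ ξ : ℝ, ξ ≠ 0 := by simp [ae_iff]
    refine tendsto_integral_filter_of_dominated_convergence
      (fun ξ => ‖symb (2 - μ) ξ * 𝓕 h.toSchwartz ξ‖) ?_ ?_ ?_ ?_
    · refine Eventually.of_forall fun ε => Measurable.aestronglyMeasurable ?_
      have := φ.continuous
      fun_prop
    · refine Eventually.of_forall fun ε => ?_
      filter_upwards [hne] with ξ hξ
      rw [norm_mul, Complex.norm_exp_ofReal_mul_I, one_mul, ← inv_cpow_mul_sq hξ, hφξ,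
        mul_assoc (_ ^ (μ : ℂ)), norm_mul, norm_mul ((1 / _ : ℂ) ^ _)]
      gcongr
      rw [Complex.norm_cpow_real, Complex.norm_cpow_real]
      have h0 : 0 < ‖((2 * Real.pi * ξ : ℝ) * Complex.I : ℂ)‖ := by
        simp [hξ, Real.pi_ne_zero]
      rw [norm_div, norm_div]
      gcongr
      have := Complex.abs_im_le_norm (ε + (2 * Real.pi * ξ : ℝ) * Complex.I)
      simpa using this
    · exact (integrable_symb_mul hμ0 hμ1 h).norm
    · filter_upwards [hne] with ξ hξ
      rw [← inv_cpow_mul_sq hξ, mul_assoc _ (_ ^ 2), ← hφξ]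
      refine Tendsto.const_mul _ (Tendsto.mul_const _ ?_)
      refine Tendsto.mono_left ?_ nhdsWithin_le_nhds
      have hz : ((2 * Real.pi * ξ : ℝ) * Complex.I : ℂ) ≠ 0 := by simp [hξ, Real.pi_ne_zero]
      have : ContinuousAt (fun ε : ℝ =>
          (1 / (ε + (2 * Real.pi * ξ : ℝ) * Complex.I)) ^ (μ : ℂ)) 0 := by
        refine (continuousAt_const.div (by fun_prop) (by simpa using hz)).cpow
          continuousAt_const ?_
        right
        simp [hξ, Real.pi_ne_zero]
      have h2 := this.tendsto
      simpa using h2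
  have hAB := tendsto_nhds_unique hA (hB.congr' (by
    filter_upwards [self_mem_nhdsWithin] with ε hε
    exact (integral_kernel_mul_exp_mul_fourierInv hμ0 hε φ.integrable x).symm))
  have hΓ : (Real.Gamma μ : ℂ) ≠ 0 := Complex.ofReal_ne_zero.2 (Real.Gamma_pos_of_pos hμ0).ne'
  rw [leftDeriv_eq hμ0 hμ1 h, leftIntegral_eq, Complex.ofReal_mul, ← integral_complex_ofReal, hAB,
    Real.fourierInv_eq']
  push_cast
  rw [← mul_assoc, one_div, inv_mul_cancel₀ hΓ, one_mul]
  congr 1; ext ξ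
  simp only [smul_eq_mul, RCLike.inner_apply, conj_trivial]
  push_cast
  congr 2
  ring

theorem rightDeriv_eq_fourierInv {μ : ℝ} (hμ0 : 0 < μ) (hμ1 : μ < 1) {ψ : ℝ → ℝ} (h : IsTest ψ)
    (x : ℝ) : (rightDeriv (2 - μ) ψ x : ℂ) =
      𝓕⁻ (fun ξ => conj (symb (2 - μ) ξ) * 𝓕 h.toSchwartz ξ) x := by
  rw [rightDeriv_eq hμ0 hμ1, leftDeriv_eq_fourierInv hμ0 hμ1 h.comp_neg,
    Real.fourierInv_eq_fourier_neg, neg_neg, Real.fourierInv_eq_fourier_comp_neg]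
  refine congrFun (congrArg 𝓕 (funext fun ξ => ?_)) x
  rw [h.fourier_comp_neg, ← symb_neg, neg_neg]

/-- A real function that is the pointwise inverse transform of `h ∈ L¹ ∩ L²` is square integrable
and has transform `h`. -/
theorem exists_L2R_of_fourierInv {g : ℝ → ℝ} {h : ℝ → ℂ} (h1 : Integrable h) (h2 : MemLp h 2)
    (hg : ∀ x, (g x : ℂ) = 𝓕⁻ h x) :
    ∃ G : L2R, G =ᵐ[volume] g ∧ plancherel G =ᵐ[volume] h := by
  have hae := fourierInv_toLp_ae h1 h2
  have hgC : MemLp (fun x => (g x : ℂ)) 2 := by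
    refine (Lp.memLp (𝓕⁻ (h2.toLp h) : Lp ℂ 2 (volume : Measure ℝ))).ae_eq ?_
    filter_upwards [hae] with x hx
    rw [hx, hg]
  have hgR : MemLp g 2 := by simpa using hgC.re
  refine ⟨hgR.toLp g, hgR.coeFn_toLp, ?_⟩
  have : Complex.ofRealCLM.compLp (hgR.toLp g) = 𝓕⁻ (h2.toLp h) := by
    apply Lp.ext
    filter_upwards [coeFn_ofRealLp (hgR.toLp g), hgR.coeFn_toLp, hae] with x e1 e2 e3
    rw [e1, e2, e3, hg]
  rw [plancherel, this, FourierTransform.fourier_fourierInv_eq]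
  exact h2.coeFn_toLp

theorem IsTest.exists_L2R {ψ : ℝ → ℝ} (h : IsTest ψ) :
    ∃ G : L2R, G =ᵐ[volume] ψ ∧ plancherel G =ᵐ[volume] fun ξ => 𝓕 h.toSchwartz ξ := by
  refine exists_L2R_of_fourierInv (𝓕 h.toSchwartz).integrable ((𝓕 h.toSchwartz).memLp 2) fun x => ?_
  rw [← SchwartzMap.fourierInv_coe, FourierTransform.fourierInv_fourier_eq]
  rfl

theorem exists_L2R_leftDeriv {μ : ℝ} (hμ0 : 0 < μ) (hμ1 : μ < 1) {ψ : ℝ → ℝ} (h : IsTest ψ) :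
    ∃ G : L2R, G =ᵐ[volume] leftDeriv (2 - μ) ψ ∧
      plancherel G =ᵐ[volume] fun ξ => symb (2 - μ) ξ * 𝓕 h.toSchwartz ξ :=
  exists_L2R_of_fourierInv (integrable_symb_mul hμ0 hμ1 h) (memLp_symb_mul hμ0 hμ1 h)
    (leftDeriv_eq_fourierInv hμ0 hμ1 h)

theorem exists_L2R_rightDeriv {μ : ℝ} (hμ0 : 0 < μ) (hμ1 : μ < 1) {ψ : ℝ → ℝ} (h : IsTest ψ) :
    ∃ G : L2R, G =ᵐ[volume] rightDeriv (2 - μ) ψ ∧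
      plancherel G =ᵐ[volume] fun ξ => conj (symb (2 - μ) ξ) * 𝓕 h.toSchwartz ξ := by
  have hm : AEStronglyMeasurable fun ξ => conj (symb (2 - μ) ξ) * 𝓕 h.toSchwartz ξ :=
    (Complex.continuous_conj.comp_aestronglyMeasurable
      (measurable_symb _).aestronglyMeasurable).mul (𝓕 h.toSchwartz).continuous.aestronglyMeasurable
  exact exists_L2R_of_fourierInv
    ((integrable_symb_mul hμ0 hμ1 h).mono hm (ae_of_all _ fun ξ => by simp))
    ((memLp_symb_mul hμ0 hμ1 h).mono hm (ae_of_all _ fun ξ => by simp))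
    (rightDeriv_eq_fourierInv hμ0 hμ1 h)

/-! ### Weak derivatives as Fourier multipliers -/

/-- Parseval's identity for an adjoint pair of multipliers: if `v̂ = m û` and `g` has transform
`conj m · ψ̂`, then `(u, g) = (v, ψ)`. -/
theorem integral_mul_eq_of_plancherel {m : ℝ → ℂ} {u v : L2R}
    (huv : plancherel v =ᵐ[volume] fun ξ => m ξ * plancherel u ξ) {ψ : ℝ → ℝ} (h : IsTest ψ)
    {g : ℝ → ℝ} (hg : ∃ G : L2R, G =ᵐ[volume] g ∧
      plancherel G =ᵐ[volume] fun ξ => conj (m ξ) * 𝓕 h.toSchwartz ξ) :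
    Integrable (fun x => u x * g x) ∧ ∫ x, u x * g x = ∫ x, v x * ψ x := by
  obtain ⟨G, hG, hG'⟩ := hg
  obtain ⟨Ψ, hΨ, hΨ'⟩ := h.exists_L2R
  have e1 : (fun x => u x * G x) =ᵐ[volume] fun x => u x * g x := by
    filter_upwards [hG] with x hx; rw [hx]
  have e2 : (fun x => v x * Ψ x) =ᵐ[volume] fun x => v x * ψ x := by
    filter_upwards [hΨ] with x hx; rw [hx]
  refine ⟨((Lp.memLp u).integrable_mul (Lp.memLp G)).congr e1, ?_⟩
  rw [← integral_congr_ae e1, ← integral_congr_ae e2]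
  apply Complex.ofReal_injective
  rw [integral_mul_eq_plancherel, integral_mul_eq_plancherel]
  refine integral_congr_ae ?_
  filter_upwards [huv, hG', hΨ'] with ξ h1 h2 h3
  rw [h1, h2, h3, map_mul, Complex.conj_conj]
  ring

theorem L2R_locallyIntegrable (u : L2R) : LocallyIntegrable u :=
  (Lp.memLp u).locallyIntegrable (by norm_num)

theorem isWeakLeftDeriv_of_plancherel {μ : ℝ} (hμ0 : 0 < μ) (hμ1 : μ < 1) {u v : L2R}
    (huv : plancherel v =ᵐ[volume] fun ξ => symb (2 - μ) ξ * plancherel u ξ) :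
    IsWeakLeftDeriv (2 - μ) u v :=
  ⟨L2R_locallyIntegrable u, L2R_locallyIntegrable v, fun _ h =>
    integral_mul_eq_of_plancherel huv h (exists_L2R_rightDeriv hμ0 hμ1 h)⟩

theorem isWeakRightDeriv_of_plancherel {μ : ℝ} (hμ0 : 0 < μ) (hμ1 : μ < 1) {u v : L2R}
    (huv : plancherel v =ᵐ[volume] fun ξ => conj (symb (2 - μ) ξ) * plancherel u ξ) :
    IsWeakRightDeriv (2 - μ) u v :=
  ⟨L2R_locallyIntegrable u, L2R_locallyIntegrable v, fun _ h =>
    integral_mul_eq_of_plancherel huv h (by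
      simpa only [Complex.conj_conj] using exists_L2R_leftDeriv hμ0 hμ1 h)⟩

theorem isWeakDeriv_of_plancherel {u v : L2R} (huv : plancherel v =ᵐ[volume]
      fun ξ => ((2 * Real.pi * ξ : ℝ) * Complex.I : ℂ) * plancherel u ξ) :
    IsWeakDeriv u v := by
  refine ⟨L2R_locallyIntegrable u, L2R_locallyIntegrable v, fun ψ h => ?_⟩
  obtain ⟨G, hG, hG'⟩ := h.deriv.exists_L2R
  have hneg : ∃ G : L2R, G =ᵐ[volume] (fun x => -deriv ψ x) ∧ plancherel G =ᵐ[volume]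
      fun ξ => conj ((2 * Real.pi * ξ : ℝ) * Complex.I : ℂ) * 𝓕 h.toSchwartz ξ := by
    refine ⟨(-1 : ℝ) • G, ?_, ?_⟩
    · filter_upwards [Lp.coeFn_smul (-1 : ℝ) G, hG] with x h1 h2
      rw [h1, Pi.smul_apply, h2]; simp
    · rw [plancherel_smul]
      filter_upwards [Lp.coeFn_smul ((-1 : ℝ) : ℂ) (plancherel G), hG'] with ξ h1 h2
      rw [h1, Pi.smul_apply, h2, h.fourier_deriv, map_mul, Complex.conj_ofReal, Complex.conj_I,
        smul_eq_mul]
      push_cast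
      ring
  have := (integral_mul_eq_of_plancherel huv h hneg).2
  rw [← this, ← integral_neg]
  simp

theorem ae_eq_of_integral_mul_test_eq {v w : ℝ → ℝ} (hv : LocallyIntegrable v)
    (hw : LocallyIntegrable w)
    (h : ∀ ψ : ℝ → ℝ, IsTest ψ → ∫ x, v x * ψ x = ∫ x, w x * ψ x) : v =ᵐ[volume] w := by
  refine ae_eq_of_integral_contDiff_smul_eq hv hw fun g hg hgc => ?_
  simpa only [smul_eq_mul, mul_comm] using h g ⟨hg, hgc⟩

/-! ### Lower bound for the symbol -/

/-- The symbol of the operator `p D^{2-μ} + q D^{(2-μ)*} + a D + b`. -/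
def opSymb (p q a b μ ξ : ℝ) : ℂ :=
  p * symb (2 - μ) ξ + q * conj (symb (2 - μ) ξ) + a * ((2 * Real.pi * ξ : ℝ) * Complex.I) + b

theorem opSymb_neg (p q a b μ ξ : ℝ) : opSymb p q a b μ (-ξ) = conj (opSymb p q a b μ ξ) := by
  simp only [opSymb, symb_neg, map_add, map_mul, Complex.conj_ofReal, Complex.conj_conj,
    Complex.conj_I]
  push_cast
  ring

theorem measurable_opSymb (p q a b μ : ℝ) : Measurable (opSymb p q a b μ) := by
  have := measurable_symb (2 - μ)
  have h2 : Measurable fun ξ => conj (symb (2 - μ) ξ) := Complex.continuous_conj.measurable.comp this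
  unfold opSymb
  fun_prop

/-- The function `∑ C_j t^{2σ_j}`, whose value at `t = |2πξ|` is the squared modulus of the symbol
at `ξ ≠ 0`. -/
def energy (p q a b μ t : ℝ) : ℝ :=
  coef p q a b μ 1 * t ^ (2 * (2 - μ)) + coef p q a b μ 2 * t ^ (3 - μ) +
    coef p q a b μ 3 * t ^ (2 : ℝ) + coef p q a b μ 4 * t ^ (2 - μ) + b ^ 2

theorem symb_of_pos (s : ℝ) {ξ : ℝ} (hξ : 0 < ξ) :
    symb s ξ = ((2 * Real.pi * ξ) ^ s : ℝ) *
      ((Real.cos (s * Real.pi / 2) : ℝ) + (Real.sin (s * Real.pi / 2) : ℝ) * Complex.I) := by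
  have ht : 0 < 2 * Real.pi * ξ := by positivity
  have hC : ((2 * Real.pi * ξ : ℝ) : ℂ) ≠ 0 := Complex.ofReal_ne_zero.2 ht.ne'
  rw [symb, Complex.cpow_def_of_ne_zero (mul_ne_zero hC Complex.I_ne_zero),
    Complex.log_ofReal_mul ht Complex.I_ne_zero, Complex.log_I, add_mul, Complex.exp_add,
    Real.rpow_def_of_pos ht, Complex.ofReal_cos, Complex.ofReal_sin, ← Complex.exp_mul_I]
  push_cast
  congr 2
  ring

theorem norm_opSymb_sq_of_pos (p q a b μ : ℝ) {ξ : ℝ} (hξ : 0 < ξ) :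
    ‖opSymb p q a b μ ξ‖ ^ 2 = energy p q a b μ (2 * Real.pi * ξ) := by
  have ht : 0 < 2 * Real.pi * ξ := by positivity
  rw [opSymb, symb_of_pos _ hξ, energy]
  set t := 2 * Real.pi * ξ with ht'
  set θ := (2 - μ) * Real.pi / 2 with hθ
  have c1 : Real.cos (sig μ 1 * Real.pi) = Real.cos θ ^ 2 - Real.sin θ ^ 2 := by
    rw [show sig μ 1 * Real.pi = 2 * θ by simp only [sig, hθ]; ring, Real.cos_two_mul']
  have c2 : Real.cos (sig μ 2 * Real.pi) = - Real.sin θ := by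
    rw [show sig μ 2 * Real.pi = θ + Real.pi / 2 by simp only [sig, hθ]; ring,
      Real.cos_add_pi_div_two]
  have c4 : Real.cos (sig μ 4 * Real.pi) = Real.cos θ := by
    rw [show sig μ 4 * Real.pi = θ by simp only [sig, hθ]; ring]
  simp only [coef, c1, c2, c4]
  rw [show 2 * (2 - μ) = (2 - μ) + (2 - μ) by ring, Real.rpow_add ht,
    show 3 - μ = (2 - μ) + 1 by ring, Real.rpow_add_one ht.ne', Real.rpow_two]
  set T := t ^ (2 - μ)
  rw [← Complex.normSq_eq_norm_sq, Complex.normSq_apply]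
  simp only [map_mul, map_add, Complex.conj_ofReal, Complex.conj_I, Complex.add_re, Complex.mul_re,
    Complex.ofReal_re, Complex.ofReal_im, Complex.I_re, Complex.I_im, Complex.add_im,
    Complex.mul_im, Complex.neg_re, Complex.neg_im]
  have := Real.sin_sq_add_cos_sq θ
  linear_combination ((p ^ 2 + q ^ 2) * T ^ 2) * this

theorem norm_opSymb_sq (p q a b μ : ℝ) {ξ : ℝ} (hξ : ξ ≠ 0) :
    ‖opSymb p q a b μ ξ‖ ^ 2 = energy p q a b μ |2 * Real.pi * ξ| := by
  rcases hξ.lt_or_gt with h | h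
  · have e : |2 * Real.pi * ξ| = 2 * Real.pi * (-ξ) := by
      rw [abs_of_neg (by have := Real.pi_pos; nlinarith)]; ring
    rw [e, ← norm_opSymb_sq_of_pos p q a b μ (neg_pos.2 h), opSymb_neg, RCLike.norm_conj]
  · rw [abs_of_pos (by positivity), norm_opSymb_sq_of_pos p q a b μ h]

/-- `C₁` is positive because `2 - μ` is not an integer. -/
theorem coef_one_pos (p q a b μ : ℝ) (hμ0 : 0 < μ) (hμ1 : μ < 1) (hpq : p ^ 2 + q ^ 2 ≠ 0) :
    0 < coef p q a b μ 1 := by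
  have e : Real.cos (sig μ 1 * Real.pi) = - Real.cos ((1 - μ) * Real.pi) := by
    rw [← Real.cos_add_pi]; congr 1; simp only [sig]; ring
  have hlt : Real.cos ((1 - μ) * Real.pi) < 1 := by
    refine lt_of_lt_of_eq ?_ Real.cos_zero
    exact Real.cos_lt_cos_of_nonneg_of_le_pi le_rfl (by nlinarith [Real.pi_pos])
      (by have := Real.pi_pos; nlinarith)
  have hgt : -1 < Real.cos ((1 - μ) * Real.pi) := by
    rw [← Real.cos_pi]
    exact Real.cos_lt_cos_of_nonneg_of_le_pi (by have := Real.pi_pos; nlinarith) le_rfl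
      (by nlinarith [Real.pi_pos])
  simp only [coef, e]
  set c := Real.cos ((1 - μ) * Real.pi)
  have hpos : 0 < p ^ 2 + q ^ 2 := lt_of_le_of_ne (by positivity) hpq.symm
  -- `p² + q² - 2pqc = (1 - c)/2 · (p + q)² + (1 + c)/2 · (p - q)²`
  nlinarith [mul_nonneg (sub_pos.2 hlt).le (sq_nonneg (p + q)),
    mul_nonneg (by linarith : 0 ≤ 1 + c) (sq_nonneg (p - q)), mul_pos hpos (sub_pos.2 hlt),
    mul_pos hpos (by linarith : 0 < 1 + c)]

/-- In each case the frequencies are split at `1/α`: below it `b²` dominates the negative terms,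
above it the term of highest order does. Both inequalities propagate from `1/α` because the
exponents are ordered, `2 - μ < 2 < 3 - μ < 2(2 - μ)`. -/
theorem energy_pos {p q a b μ : ℝ} (hμ0 : 0 < μ) (hμ1 : μ < 1) (hb : b ≠ 0)
    (hpq : p ^ 2 + q ^ 2 ≠ 0)
    (hcase : CaseI p q a b μ ∨ ∃ α : ℝ, 0 < α ∧
        (CaseII p q a b μ α ∨ CaseIII p q a b μ α ∨ CaseIV p q a b μ α)) {t : ℝ} (ht : 0 ≤ t) :
    0 < energy p q a b μ t := by
  have h1 := coef_one_pos p q a b μ hμ0 hμ1 hpq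
  have h3 : 0 ≤ coef p q a b μ 3 := sq_nonneg a
  have hb2 : 0 < b ^ 2 := by positivity
  rcases hcase with ⟨h2, h4⟩ | ⟨α, hα, hc⟩
  · unfold energy; positivity
  set β := α⁻¹ with hβ
  have hβ0 : 0 < β := inv_pos.2 hα
  have e1 : ∀ x : ℝ, α ^ (2 * (0 - x)) = β ^ (2 * x) := fun x => by
    rw [hβ, Real.inv_rpow hα.le, ← Real.rpow_neg hα.le]; ring_nf
  have e2 : ∀ c x : ℝ, c / α ^ (2 * x - 1) = c * β ^ (2 * x) * α := fun c x => by
    rw [hβ, Real.inv_rpow hα.le, Real.rpow_sub_one hα.ne']; field_simp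
  simp only [CaseII, CaseIII, CaseIV, Finset.sum_Icc_succ_top (show 2 ≤ 3 + 1 by norm_num),
    Finset.sum_Icc_succ_top (show 2 ≤ 2 + 1 by norm_num),
    Finset.sum_Icc_succ_top (show 1 ≤ 3 + 1 by norm_num),
    Finset.sum_Icc_succ_top (show 1 ≤ 2 + 1 by norm_num),
    Finset.sum_Icc_succ_top (show 1 ≤ 1 + 1 by norm_num), Finset.Icc_self,
    Finset.sum_singleton, Finset.sum_insert (show (2 : ℕ) ∉ ({4} : Finset ℕ) by decide),
    Finset.sum_insert (show (1 : ℕ) ∉ ({2, 4} : Finset ℕ) by decide),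
    show sig μ 5 = 0 from rfl, e1, e2, ← add_mul, mul_pos_iff_of_pos_right hα, Nat.reduceAdd] at hc
  simp only [show 2 * sig μ 1 = 2 * (2 - μ) from rfl,
    show 2 * sig μ 2 = 3 - μ by simp only [sig]; ring,
    show 2 * sig μ 3 = 2 by simp only [sig]; ring,
    show 2 * sig μ 4 = 2 - μ by simp only [sig]; ring] at hc
  unfold energy
  set C1 := coef p q a b μ 1
  set C2 := coef p q a b μ 2
  set C3 := coef p q a b μ 3
  set C4 := coef p q a b μ 4
  -- for `t = β r` every power of `t` is that of `β`, times a power of `r` that compares with `1`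
  -- and with the other powers of `r`
  obtain ⟨r, hr0, rfl⟩ : ∃ r : ℝ, 0 ≤ r ∧ β * r = t :=
    ⟨t / β, by positivity, by field_simp⟩
  simp only [Real.mul_rpow hβ0.le hr0, ← mul_assoc]
  have A0 : 0 < β ^ (2 * (2 - μ)) := by positivity
  have B0 : 0 < β ^ (3 - μ) := by positivity
  have Q0 : 0 < β ^ (2 : ℝ) := by positivity
  have D0 : 0 < β ^ (2 - μ) := by positivity
  set A := β ^ (2 * (2 - μ))
  set B := β ^ (3 - μ)
  set Q := β ^ (2 : ℝ)
  set D := β ^ (2 - μ)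
  have rA : 0 ≤ r ^ (2 * (2 - μ)) := by positivity
  have rB : 0 ≤ r ^ (3 - μ) := by positivity
  have rQ : 0 ≤ r ^ (2 : ℝ) := by positivity
  have rD : 0 ≤ r ^ (2 - μ) := by positivity
  have m1 := mul_nonneg (mul_nonneg h1.le A0.le) rA
  have m3 := mul_nonneg (mul_nonneg h3 Q0.le) rQ
  rcases le_total r 1 with hr | hr
  · have lB : r ^ (3 - μ) ≤ 1 := Real.rpow_le_one hr0 hr (by linarith)
    have lD : r ^ (2 - μ) ≤ 1 := Real.rpow_le_one hr0 hr (by linarith)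
    rcases hc with ⟨h2, h4, hs, -⟩ | ⟨h2, h4, hs, -⟩ | ⟨h2, h4, hs, -⟩
    · have m2 := mul_nonneg (mul_nonneg h2 B0.le) rB
      have m4 := mul_le_mul_of_nonpos_left lD (mul_neg_of_neg_of_pos h4 D0).le
      linarith
    · rcases hr0.eq_or_lt with rfl | hr0
      · rw [Real.zero_rpow (by linarith), Real.zero_rpow (by linarith),
          Real.zero_rpow (by linarith), Real.zero_rpow (by linarith)]
        linarith
      have rB' : 0 < r ^ (3 - μ) := by positivity
      have lQB : r ^ (3 - μ) ≤ r ^ (2 : ℝ) :=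
        Real.rpow_le_rpow_of_exponent_ge hr0 hr (by linarith)
      have lDB : r ^ (3 - μ) ≤ r ^ (2 - μ) :=
        Real.rpow_le_rpow_of_exponent_ge hr0 hr (by linarith)
      have m0 := mul_le_mul_of_nonneg_left lB hb2.le
      have m3' := mul_le_mul_of_nonneg_left lQB (mul_nonneg h3 Q0.le)
      have m4 := mul_le_mul_of_nonneg_left lDB (mul_nonneg h4 D0.le)
      have m := mul_pos (neg_lt_iff_pos_add.1 hs) rB'
      linarith
    · have m2 := mul_le_mul_of_nonpos_left lB (mul_neg_of_neg_of_pos h2 B0).le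
      have m4 := mul_le_mul_of_nonpos_left lD (mul_neg_of_neg_of_pos h4 D0).le
      linarith
  · have hr0' : 0 < r := by linarith
    have rB' : 0 < r ^ (3 - μ) := by positivity
    have rD' : 0 < r ^ (2 - μ) := by positivity
    have lBA : r ^ (3 - μ) ≤ r ^ (2 * (2 - μ)) :=
      Real.rpow_le_rpow_of_exponent_le hr (by linarith)
    have lDB : r ^ (2 - μ) ≤ r ^ (3 - μ) := Real.rpow_le_rpow_of_exponent_le hr (by linarith)
    have lDQ : r ^ (2 - μ) ≤ r ^ (2 : ℝ) := Real.rpow_le_rpow_of_exponent_le hr (by linarith)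
    have m1' := mul_le_mul_of_nonneg_left lBA (mul_nonneg h1.le A0.le)
    rcases hc with ⟨h2, h4, -, hs⟩ | ⟨h2, h4, -, hs⟩ | ⟨h2, h4, -, hs⟩
    · have n1 := mul_le_mul_of_nonneg_left (lDB.trans lBA) (mul_nonneg h1.le A0.le)
      have n2 := mul_le_mul_of_nonneg_left lDB (mul_nonneg h2 B0.le)
      have n3 := mul_le_mul_of_nonneg_left lDQ (mul_nonneg h3 Q0.le)
      have m := mul_pos hs rD'
      linarith
    · have n4 := mul_nonneg (mul_nonneg h4 D0.le) rD
      have m := mul_pos hs rB'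
      linarith
    · have n4 := mul_le_mul_of_nonpos_left lDB (mul_neg_of_neg_of_pos h4 D0).le
      have m := mul_pos hs rB'
      linarith

/-- A nowhere vanishing symbol is bounded below by the weight of `Ĥ^{2-μ}`: by compactness for
bounded frequencies, and because `C₁ > 0` for large ones. -/
theorem exists_le_energy {p q a b μ : ℝ} (hμ0 : 0 < μ) (hμ1 : μ < 1)
    (h1 : 0 < coef p q a b μ 1) (hpos : ∀ t, 0 ≤ t → 0 < energy p q a b μ t) :
    ∃ c : ℝ, 0 < c ∧ ∀ t, 0 ≤ t → c * (1 + t ^ (2 * (2 - μ))) ≤ energy p q a b μ t := by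
  set F : ℝ → ℝ := fun t => energy p q a b μ t / (1 + t ^ (2 * (2 - μ))) with hF
  have hden : ∀ t : ℝ, 0 ≤ t → 0 < 1 + t ^ (2 * (2 - μ)) := fun t ht => by positivity
  have hcontE : Continuous (energy p q a b μ) := by
    unfold energy
    have := fun (e : ℝ) (he : 0 ≤ e) => Real.continuous_rpow_const he
    have i1 := this (2 * (2 - μ)) (by linarith)
    have i2 := this (3 - μ) (by linarith)
    have i3 := this 2 (by norm_num)
    have i4 := this (2 - μ) (by linarith)
    fun_prop
  have hlim : Tendsto (fun t : ℝ => coef p q a b μ 1 + coef p q a b μ 2 * t ^ (-(1 - μ)) +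
      coef p q a b μ 3 * t ^ (-(2 * (1 - μ))) + coef p q a b μ 4 * t ^ (-(2 - μ)) +
      b ^ 2 * t ^ (-(2 * (2 - μ)))) atTop (𝓝 (coef p q a b μ 1)) := by
    have z := fun (e : ℝ) (he : 0 < e) (C : ℝ) => (tendsto_rpow_neg_atTop he).const_mul C
    have := ((((tendsto_const_nhds (x := coef p q a b μ 1)).add
      (z (1 - μ) (by linarith) (coef p q a b μ 2))).add
      (z (2 * (1 - μ)) (by linarith) (coef p q a b μ 3))).add
      (z (2 - μ) (by linarith) (coef p q a b μ 4))).add (z (2 * (2 - μ)) (by linarith) (b ^ 2))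
    simpa using this
  obtain ⟨T, hT⟩ := eventually_atTop.1
    ((hlim.eventually (lt_mem_nhds (half_lt_self h1))).and (eventually_ge_atTop 1))
  obtain ⟨t₀, ht₀, hmin⟩ := (isCompact_Icc (a := (0 : ℝ)) (b := max T 0)).exists_isMinOn
    ⟨0, by simp⟩ (f := F) (by
      refine hcontE.continuousOn.div ?_ fun t ht => (hden t ht.1).ne'
      have := Real.continuous_rpow_const (q := 2 * (2 - μ)) (by linarith)
      fun_prop)
  have hF0 : 0 < F t₀ := div_pos (hpos _ ht₀.1) (hden _ ht₀.1)
  refine ⟨min (F t₀) (coef p q a b μ 1 / 4), by positivity, fun t ht => ?_⟩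
  rcases le_total t (max T 0) with h | h
  · have := hmin (⟨ht, h⟩ : t ∈ Set.Icc 0 (max T 0))
    calc _ ≤ F t * (1 + t ^ (2 * (2 - μ))) :=
          mul_le_mul_of_nonneg_right ((min_le_left _ _).trans this) (hden t ht).le
      _ = _ := div_mul_cancel₀ _ (hden t ht).ne'
  · obtain ⟨hT1, hT2⟩ := hT t ((le_max_left _ _).trans h)
    have ht0 : 0 < t := by linarith
    have hA : 1 ≤ t ^ (2 * (2 - μ)) := Real.one_le_rpow hT2 (by linarith)
    have e : energy p q a b μ t = (coef p q a b μ 1 + coef p q a b μ 2 * t ^ (-(1 - μ)) +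
      coef p q a b μ 3 * t ^ (-(2 * (1 - μ))) + coef p q a b μ 4 * t ^ (-(2 - μ)) +
      b ^ 2 * t ^ (-(2 * (2 - μ)))) * t ^ (2 * (2 - μ)) := by
      simp only [add_mul, mul_assoc, ← Real.rpow_add ht0]
      unfold energy
      ring_nf
      simp
    rw [e]
    calc _ ≤ coef p q a b μ 1 / 4 * (1 + t ^ (2 * (2 - μ))) :=
          mul_le_mul_of_nonneg_right (min_le_right _ _) (hden t ht).le
      _ ≤ coef p q a b μ 1 / 2 * t ^ (2 * (2 - μ)) := by nlinarith
      _ ≤ _ := mul_le_mul_of_nonneg_right hT1.le (by positivity)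

/-! ### Strong solutions on the Fourier side -/

theorem sq_le_one_add_rpow {μ : ℝ} (hμ1 : μ < 1) {t : ℝ} (ht : 0 ≤ t) :
    t ^ 2 ≤ 1 + t ^ (2 * (2 - μ)) := by
  rcases le_total t 1 with h | h
  · have := Real.rpow_nonneg ht (2 * (2 - μ))
    nlinarith
  · have := Real.rpow_le_rpow_of_exponent_le h (by linarith : (2 : ℝ) ≤ 2 * (2 - μ))
    rw [Real.rpow_two] at this
    linarith

theorem memLp_mul_plancherel {s : ℝ} {u : L2R} (hu : u ∈ HHat s) {m : ℝ → ℂ} (hm : Measurable m)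
    (hle : ∀ ξ, ‖m ξ‖ ^ 2 ≤ 1 + |2 * Real.pi * ξ| ^ (2 * s)) :
    MemLp (fun ξ => m ξ * plancherel u ξ) 2 := by
  have hmeas : AEStronglyMeasurable (fun ξ => m ξ * plancherel u ξ) :=
    hm.aestronglyMeasurable.mul (Lp.aestronglyMeasurable _)
  refine (memLp_two_iff_integrable_sq_norm hmeas).2
    (Integrable.mono' hu (hmeas.norm.pow 2) (ae_of_all _ fun ξ => ?_))
  rw [norm_mul, mul_pow, Real.norm_of_nonneg (by positivity)]
  gcongr
  exact hle ξ

theorem exists_plancherel_eq_mul {s : ℝ} {u : L2R} (hu : u ∈ HHat s) {m : ℝ → ℂ}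
    (hm : Measurable m) (hle : ∀ ξ, ‖m ξ‖ ^ 2 ≤ 1 + |2 * Real.pi * ξ| ^ (2 * s))
    (hneg : ∀ ξ, m (-ξ) = conj (m ξ)) :
    ∃ v : L2R, plancherel v =ᵐ[volume] fun ξ => m ξ * plancherel u ξ := by
  refine exists_plancherel_eq (memLp_mul_plancherel hu hm hle) ?_
  filter_upwards [plancherel_neg u] with ξ hξ
  rw [hneg, hξ, map_mul]

theorem norm_symb_sq (s ξ : ℝ) : ‖symb s ξ‖ ^ 2 = |2 * Real.pi * ξ| ^ (2 * s) := by
  rw [norm_symb, ← Real.rpow_natCast, ← Real.rpow_mul (abs_nonneg _)]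
  congr 1
  push_cast
  ring

/-- Members of `Ĥ^{2-μ}` have square integrable weak derivatives of the three orders, and the
operator acts on them as multiplication by its symbol. -/
theorem exists_weak_derivs {μ : ℝ} (hμ0 : 0 < μ) (hμ1 : μ < 1) {u : L2R} (hu : u ∈ HHat (2 - μ))
    (p q a b : ℝ) :
    ∃ v w z : L2R, IsWeakLeftDeriv (2 - μ) u v ∧ IsWeakRightDeriv (2 - μ) u w ∧ IsWeakDeriv u z ∧
      plancherel (p • v + q • w + a • z + b • u) =ᵐ[volume]
        fun ξ => opSymb p q a b μ ξ * plancherel u ξ := by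
  obtain ⟨v, hv⟩ := exists_plancherel_eq_mul hu (measurable_symb (2 - μ))
    (fun ξ => (norm_symb_sq _ ξ).le.trans (le_add_of_nonneg_left zero_le_one)) (symb_neg _)
  obtain ⟨w, hw⟩ := exists_plancherel_eq_mul hu (m := fun ξ => conj (symb (2 - μ) ξ))
    (Complex.continuous_conj.measurable.comp (measurable_symb (2 - μ)))
    (fun ξ => by
      rw [RCLike.norm_conj]
      exact (norm_symb_sq _ ξ).le.trans (le_add_of_nonneg_left zero_le_one))
    (fun ξ => by rw [symb_neg])
  obtain ⟨z, hz⟩ := exists_plancherel_eq_mul hu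
    (m := fun ξ => ((2 * Real.pi * ξ : ℝ) * Complex.I : ℂ)) (by fun_prop)
    (fun ξ => by
      rw [norm_mul, Complex.norm_I, mul_one, Complex.norm_real, Real.norm_eq_abs]
      exact sq_le_one_add_rpow hμ1 (abs_nonneg _))
    (fun ξ => by
      rw [map_mul, Complex.conj_ofReal, Complex.conj_I]; push_cast; ring)
  refine ⟨v, w, z, isWeakLeftDeriv_of_plancherel hμ0 hμ1 hv,
    isWeakRightDeriv_of_plancherel hμ0 hμ1 hw, isWeakDeriv_of_plancherel hz, ?_⟩
  simp only [plancherel_add, plancherel_smul]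
  filter_upwards [hv, hw, hz, Lp.coeFn_add ((p : ℂ) • plancherel v + (q : ℂ) • plancherel w +
      (a : ℂ) • plancherel z) ((b : ℂ) • plancherel u),
    Lp.coeFn_add ((p : ℂ) • plancherel v + (q : ℂ) • plancherel w) ((a : ℂ) • plancherel z),
    Lp.coeFn_add ((p : ℂ) • plancherel v) ((q : ℂ) • plancherel w),
    Lp.coeFn_smul (p : ℂ) (plancherel v), Lp.coeFn_smul (q : ℂ) (plancherel w),
    Lp.coeFn_smul (a : ℂ) (plancherel z), Lp.coeFn_smul (b : ℂ) (plancherel u)]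
    with ξ h1 h2 h3 h4 h5 h6 h7 h8 h9 h10
  rw [h4, Pi.add_apply, h5, Pi.add_apply, h6, Pi.add_apply, h7, h8, h9, h10]
  simp only [Pi.smul_apply, smul_eq_mul, h1, h2, h3, opSymb]
  ring

theorem coeFn_combination (p q a b : ℝ) (v w z u : L2R) :
    (p • v + q • w + a • z + b • u : L2R) =ᵐ[volume]
      fun x => p * v x + q * w x + a * z x + b * u x := by
  filter_upwards [Lp.coeFn_add (p • v + q • w + a • z) (b • u),
    Lp.coeFn_add (p • v + q • w) (a • z), Lp.coeFn_add (p • v) (q • w),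
    Lp.coeFn_smul p v, Lp.coeFn_smul q w, Lp.coeFn_smul a z, Lp.coeFn_smul b u]
    with x h4 h5 h6 h7 h8 h9 h10
  rw [h4, Pi.add_apply, h5, Pi.add_apply, h6, Pi.add_apply, h7, h8, h9, h10]
  rfl

/-- Strong solutions are the members of `Ĥ^{2-μ}` that solve the transformed equation. -/
theorem isStrongSolution_iff {μ : ℝ} (hμ0 : 0 < μ) (hμ1 : μ < 1) (p q a b : ℝ) (f u : L2R) :
    IsStrongSolution p q a b μ f u ↔ u ∈ HHat (2 - μ) ∧
      ∀ᵐ ξ, opSymb p q a b μ ξ * plancherel u ξ = plancherel f ξ := by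
  refine and_congr_right fun hu => ?_
  obtain ⟨v, w, z, hv, hw, hz, he⟩ := exists_weak_derivs hμ0 hμ1 hu p q a b
  constructor
  · rintro ⟨v', w', z', hv', hw', hz', heq⟩
    have ev : v' =ᵐ[volume] v := ae_eq_of_integral_mul_test_eq hv'.2.1 hv.2.1 fun ψ hψ =>
      (hv'.2.2 ψ hψ).2.symm.trans (hv.2.2 ψ hψ).2
    have ew : w' =ᵐ[volume] w := ae_eq_of_integral_mul_test_eq hw'.2.1 hw.2.1 fun ψ hψ =>
      (hw'.2.2 ψ hψ).2.symm.trans (hw.2.2 ψ hψ).2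
    have ez : z' =ᵐ[volume] z := ae_eq_of_integral_mul_test_eq hz'.2.1 hz.2.1 fun ψ hψ =>
      neg_injective ((hz'.2.2 ψ hψ).symm.trans (hz.2.2 ψ hψ))
    have : p • v + q • w + a • z + b • u = f := by
      apply Lp.ext
      filter_upwards [coeFn_combination p q a b v w z u, ev, ew, ez, heq] with x h0 h1 h2 h3 h4
      rw [h0, ← h1, ← h2, ← h3, h4]
    rw [this] at he
    filter_upwards [he] with ξ hξ
    exact hξ.symm
  · intro h
    have : p • v + q • w + a • z + b • u = f := by
      apply plancherel_injective
      apply Lp.ext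
      filter_upwards [he, h] with ξ h1 h2
      rw [h1, h2]
    refine ⟨v, w, z, hv, hw, hz, ?_⟩
    filter_upwards [coeFn_combination p q a b v w z u] with x hx
    rw [← hx, this]

theorem hhatNorm_sq {s : ℝ} {u : L2R} (hu : u ∈ HHat s) :
    hhatNorm s u ^ 2 = ∫ ξ, (1 + |2 * Real.pi * ξ| ^ (2 * s)) * ‖plancherel u ξ‖ ^ 2 := by
  have i1 : Integrable fun ξ => ‖plancherel u ξ‖ ^ 2 :=
    (memLp_two_iff_integrable_sq_norm (Lp.aestronglyMeasurable _)).1 (Lp.memLp (plancherel u))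
  have e : ∀ ξ, (|2 * Real.pi * ξ| ^ s * ‖plancherel u ξ‖) ^ 2 =
      (1 + |2 * Real.pi * ξ| ^ (2 * s)) * ‖plancherel u ξ‖ ^ 2 - ‖plancherel u ξ‖ ^ 2 := by
    intro ξ
    rw [mul_pow, ← norm_symb, norm_symb_sq]
    ring
  rw [hhatNorm, Real.sq_sqrt (add_nonneg (sq_nonneg _) (integral_nonneg fun ξ => sq_nonneg _))]
  simp_rw [e]
  rw [integral_sub hu i1, norm_sq_eq_integral]
  ring

end FracODE

end

theorem mainTheorem2 (p q a b μ : ℝ) (hμ0 : 0 < μ) (hμ1 : μ < 1) (hb : b ≠ 0)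
    (hpq : p ^ 2 + q ^ 2 ≠ 0)
    (hcase : FracODE.CaseI p q a b μ ∨
      ∃ α : ℝ, 0 < α ∧
        (FracODE.CaseII p q a b μ α ∨ FracODE.CaseIII p q a b μ α ∨
          FracODE.CaseIV p q a b μ α)) :
    ∃ C : ℝ, 0 < C ∧ ∀ f : FracODE.L2R,
      (∃! u : FracODE.L2R, FracODE.IsStrongSolution p q a b μ f u) ∧
        ∀ u : FracODE.L2R, FracODE.IsStrongSolution p q a b μ f u →
          FracODE.hhatNorm (2 - μ) u ≤ C * ‖f‖ := by
  open FracODE in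
  obtain ⟨c, hc, hlow⟩ := exists_le_energy hμ0 hμ1 (coef_one_pos p q a b μ hμ0 hμ1 hpq)
    fun t ht => energy_pos hμ0 hμ1 hb hpq hcase ht
  have hP : ∀ᵐ ξ : ℝ, c * (1 + |2 * Real.pi * ξ| ^ (2 * (2 - μ))) ≤
      ‖opSymb p q a b μ ξ‖ ^ 2 := by
    filter_upwards [(by simp [ae_iff] : ∀ᵐ ξ : ℝ, ξ ≠ 0)] with ξ hξ
    rw [norm_opSymb_sq p q a b μ hξ]
    exact hlow _ (abs_nonneg _)
  have hP0 : ∀ᵐ ξ : ℝ, opSymb p q a b μ ξ ≠ 0 := by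
    filter_upwards [hP] with ξ hξ h0
    have : 0 < c * (1 + |2 * Real.pi * ξ| ^ (2 * (2 - μ))) := by positivity
    rw [h0, norm_zero] at hξ
    linarith
  -- the weighted norm of a solution of the transformed equation is controlled by the data
  have hbound : ∀ (f : L2R) (g : ℝ → ℂ),
      (∀ᵐ ξ, opSymb p q a b μ ξ * g ξ = plancherel f ξ) →
      ∀ᵐ ξ, (1 + |2 * Real.pi * ξ| ^ (2 * (2 - μ))) * ‖g ξ‖ ^ 2 ≤
        c⁻¹ * ‖plancherel f ξ‖ ^ 2 := by
    intro f g hg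
    filter_upwards [hP, hg] with ξ h1 h2
    rw [← h2, norm_mul, mul_pow, inv_mul_eq_div, le_div_iff₀ hc]
    calc _ = c * (1 + |2 * Real.pi * ξ| ^ (2 * (2 - μ))) * ‖g ξ‖ ^ 2 := by ring
      _ ≤ _ := by gcongr
  have hint : ∀ f : L2R, Integrable fun ξ => c⁻¹ * ‖plancherel f ξ‖ ^ 2 := fun f =>
    ((memLp_two_iff_integrable_sq_norm (Lp.aestronglyMeasurable _)).1
      (Lp.memLp (plancherel f))).const_mul _
  have hw : Measurable fun ξ : ℝ => 1 + |2 * Real.pi * ξ| ^ (2 * (2 - μ)) := by fun_prop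
  refine ⟨√c⁻¹, by positivity, fun f => ⟨?_, fun u hu => ?_⟩⟩
  · set h : ℝ → ℂ := fun ξ => plancherel f ξ / opSymb p q a b μ ξ with hh
    have hmul : ∀ᵐ ξ, opSymb p q a b μ ξ * h ξ = plancherel f ξ := by
      filter_upwards [hP0] with ξ hξ
      rw [hh, mul_div_cancel₀ _ hξ]
    have hmeas : AEStronglyMeasurable h :=
      ((Lp.aestronglyMeasurable (plancherel f)).aemeasurable.div
        (measurable_opSymb p q a b μ).aemeasurable).aestronglyMeasurable
    have hI : Integrable fun ξ => (1 + |2 * Real.pi * ξ| ^ (2 * (2 - μ))) * ‖h ξ‖ ^ 2 := by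
      refine (hint f).mono' (hw.aestronglyMeasurable.mul (hmeas.norm.pow 2)) ?_
      filter_upwards [hbound f h hmul] with ξ hξ
      rwa [Real.norm_of_nonneg (by positivity)]
    have hL2 : MemLp h 2 := by
      refine (memLp_two_iff_integrable_sq_norm hmeas).2
        (hI.mono' (hmeas.norm.pow 2) (ae_of_all _ fun ξ => ?_))
      rw [Real.norm_of_nonneg (by positivity)]
      exact le_mul_of_one_le_left (by positivity) (le_add_of_nonneg_right (by positivity))
    obtain ⟨u, hu⟩ := exists_plancherel_eq hL2 (by
      filter_upwards [plancherel_neg f] with ξ hξ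
      simp only [hh, hξ, opSymb_neg, map_div₀])
    refine ⟨u, (isStrongSolution_iff hμ0 hμ1 p q a b f u).2 ⟨?_, ?_⟩, fun v hv => ?_⟩
    · refine hI.congr ?_
      filter_upwards [hu] with ξ hξ
      rw [hξ]
    · filter_upwards [hu, hmul] with ξ h1 h2
      rw [h1, h2]
    · apply plancherel_injective
      apply Lp.ext
      filter_upwards [((isStrongSolution_iff hμ0 hμ1 p q a b f v).1 hv).2, hu, hP0]
        with ξ h1 h2 h3
      rw [h2]
      exact eq_div_of_mul_eq h3 ((mul_comm _ _).trans h1)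
  · obtain ⟨hu1, hu2⟩ := (isStrongSolution_iff hμ0 hμ1 p q a b f u).1 hu
    refine le_of_sq_le_sq ?_ (by positivity)
    rw [hhatNorm_sq hu1, mul_pow, Real.sq_sqrt (by positivity), norm_sq_eq_integral,
      ← integral_const_mul]
    exact integral_mono_ae hu1 (hint f) (hbound f _ hu2)
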